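/- Conventions. The square $(i,j)$ lies in the $i$th column from the left and the $j$th row from the bottom ($i,j\ge 1$), and $R(i,j)$ is the set of squares $(p,q)$ with $1\le p\le i$, $1\le q\le j$. A Ferrers board is a finite set $F$ of squares with $R(i,j)\subseteq F$ for all $(i,j)\in F$. A rook placement on $F$ is a subset $P\subseteq F$ with at most one square in each row and each column; it is identified with the partial permutation sending $i$ to $j$ for $(i,j)\in P$. Fix $k\ge 2$. An occurrence of $k\cdots 1$ in $P$ is a sequence $S_1,\dots,S_k$ of squares of $P$ with strictly increasing columns and strictly decreasing rows, all contained in one rectangular subboard of $F$. Occurrences are ordered lexicographically by their sequences of rows. If $S_1,\dots,S_k$ is the smallest occurrence, $\phi(P)$ is obtained from $P$ by replacing $S_1,\dots,S_k$ by the squares in the same columns whose rows are $\mathrm{row}(S_2),\dots,\mathrm{row}(S_k),\mathrm{row}(S_1)$, respectively; if there is no occurrence, $\phi(P)=P$. The growth diagram of a placement $P$ on $F$ assigns a partition to each corner of each square of $F$: the empty partition on the left and bottom edges, and otherwise, for a square with partitions $SW,NW,SE$ at its other corners, $NE$ is given by: (1) if $NW\ne SE$, then $NE=NW\cup SE$ (entrywise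 maximum); (2) if $SW\neq NW=SE$, where $NW$ arises from $SW$ by adding $1$ to the $i$th entry, then $NE$ arises from $NW$ by adding $1$ to the $(i+1)$th entry; (3) if $SW=NW=SE$, then $NE$ is $SW$ with $1$ added to its first entry if the square is in $P$, and $NE=SW$ otherwise. Let $\mathrm{seq}(P,F)$ be the sequence of partitions along the right/up border of $F$ (the border of $F$ minus its bottom and left edges). Let $\mathrm{ins}$ and $\mathrm{rec}$ denote the Robinson–Schensted insertion and recording tableaux of a placement (that is, of its partial permutation). Main Lemma. Let $k\ge 2$, let $P$ be a rook placement on a Ferrers board $F$ that has an occurrence of $k\cdots1$, let $S=S_1\cdots S_k$ be the smallest one, and put $a=\mathrm{col}(S_k)$, $b=\mathrm{row}(S_1)$. Then $R=R(a,b)$ is the smallest rectangular subboard of $F$ that contains $S$ and extends to the left and bottom edges of $F$. Let $P_R=P\cap R$ and $\phi(P)_R=\phi(P)\cap R$. Then $$\mathrm{seq}(P_R,R)=\mathrm{seq}(\phi(P)_R,R)\quad\text{except possibly at the northeast corner of }R;$$ moreover $$\mathrm{ins}\big(P\cap R(a,b-1)\big)=\mathrm{ins}\big(\phi(P)\cap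 R(a,b-1)\big)\quad\text{and}\quad \mathrm{rec}\big(P\cap R(a-1,b)\big)=\mathrm{rec}\big(\phi(P)\cap R(a-1,b)\big).$$ -/

import Mathlib

namespace RookGrowth

/-- A square `(i, j)` is the one in the `i`th column from the left and the `j`th row from the
bottom; columns and rows are numbered from `1`. -/
abbrev Square := ℕ × ℕ

/-- The rectangle `R(i, j)` of all squares `(p, q)` with `1 ≤ p ≤ i` and `1 ≤ q ≤ j`. -/
def rect (i j : ℕ) : Finset Square := Finset.Icc 1 i ×ˢ Finset.Icc 1 j

/-- A Ferrers board (in French notation). -/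
def IsFerrersBoard (F : Finset Square) : Prop :=
  ∀ x ∈ F, 1 ≤ x.1 ∧ 1 ≤ x.2 ∧ rect x.1 x.2 ⊆ F

/-- A rook placement on `F`: at most one square in each column and at most one in each row. -/
def IsRookPlacement (F P : Finset Square) : Prop :=
  P ⊆ F ∧ (∀ x ∈ P, ∀ y ∈ P, x.1 = y.1 → x = y) ∧ (∀ x ∈ P, ∀ y ∈ P, x.2 = y.2 → x = y)

/-- An occurrence of `k ⋯ 1` in the placement `P` on `F`: squares of `P`, listed from left to
right, with decreasing rows, all contained in one rectangular subboard of `F`. -/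
def IsOccurrence (F P : Finset Square) {k : ℕ} (S : Fin k → Square) : Prop :=
  (∀ t, S t ∈ P) ∧ StrictMono (fun t => (S t).1) ∧ StrictAnti (fun t => (S t).2) ∧
    ∃ p q : Square, Finset.Icc p q ⊆ F ∧ ∀ t, S t ∈ Finset.Icc p q

/-- The smallest occurrence of `k ⋯ 1`, for the lexicographic order on the sequences of rows
(that is, of values of the associated partial permutation). -/
def IsSmallestOccurrence (F P : Finset Square) {k : ℕ} (S : Fin k → Square) : Prop :=
  IsOccurrence F P S ∧ ∀ T : Fin k → Square, IsOccurrence F P T →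
    toLex (fun t => (S t).2) ≤ toLex (fun t => (T t).2)

/-- Put into the columns of `S 0, S 1, …, S (k - 1)` the rows of `S 1, …, S (k - 1), S 0`,
leaving all other markers of `P` fixed (`finRotate k` is the cycle `t ↦ t + 1` of `Fin k`). -/
def cycleRows (P : Finset Square) {k : ℕ} (S : Fin k → Square) : Finset Square :=
  (P \ Finset.univ.image S) ∪ Finset.univ.image (fun t => ((S t).1, (S (finRotate k t)).2))

open Classical in
/-- The map `φ` on rook placements on `F`: it acts on the smallest occurrence of `k ⋯ 1`
and fixes `P` if there is none. -/
noncomputable def phi (k : ℕ) (F P : Finset Square) : Finset Square :=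
  if h : ∃ S : Fin k → Square, IsSmallestOccurrence F P S then cycleRows P h.choose else P

/-! ### Growth diagrams -/

/-- A partition, given by its entries `l 0 ≥ l 1 ≥ …`; the absence of an entry is regarded
as the presence of an entry `0`. The empty partition is `0`. -/
abbrev Entries := ℕ → ℕ

open Classical in
/-- The local rules: the partition at the northeast corner of a square, from those at the
southwest, northwest and southeast corners and the presence of a marker in the square.
In the second rule `sInf {i | SW i ≠ NW i}` is the index of the entry of `SW` to which `1` is
added to obtain `NW`. -/
noncomputable def localRule (SW NW SE : Entries) (marked : Prop) : Entries :=
  if NW ≠ SE then fun i => max (NW i) (SE i)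
  else if SW ≠ NW then NW + Pi.single (sInf {i | SW i ≠ NW i} + 1) 1
  else if marked then SW + Pi.single 0 1
  else SW

/-- The partition that the growth diagram of `P` assigns to the lattice point `(i, j)`, the
northeast corner of the square `(i, j)` (and the points with `i = 0` or `j = 0` are those of the
left and bottom edges). -/
noncomputable def growth (P : Finset Square) : ℕ → ℕ → Entries
  | 0, _ => 0
  | _ + 1, 0 => 0
  | i + 1, j + 1 =>
    localRule (growth P i j) (growth P i (j + 1)) (growth P (i + 1) j) ((i + 1, j + 1) ∈ P)
termination_by i j => (i, j)

/-- The lattice points on the right/up border of `F`: the corners of squares of `F` that are not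
the southwest corner of a square of `F`. -/
def border (F : Finset Square) : Set (ℕ × ℕ) :=
  {c | (∃ x ∈ F, (c.1 = x.1 ∨ c.1 + 1 = x.1) ∧ (c.2 = x.2 ∨ c.2 + 1 = x.2)) ∧
    (c.1 + 1, c.2 + 1) ∉ F}

/-- `seq(P, F)`: the partitions along the right/up border of `F` in the growth diagram of `P`,
indexed by the corners on that border. -/
noncomputable def borderSeq (P F : Finset Square) (c : border F) : Entries :=
  growth P c.1.1 c.1.2

/-! ### The Robinson-Schensted correspondence -/

/-- A tableau, as the list of its rows from top to bottom. -/
abbrev Tableau := List (List ℕ)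

/-- Insert `x` into a row: `x` replaces the leftmost entry larger than `x`, which is bumped
and returned; if there is none, `x` is placed at the right end. -/
def rowInsert (x : ℕ) : List ℕ → List ℕ × Option ℕ
  | [] => ([x], none)
  | y :: ys =>
    if x < y then (x :: ys, some y)
    else (y :: (rowInsert x ys).1, (rowInsert x ys).2)

/-- Insert `x` into a tableau; also returns the index of the row in which the new position
became occupied (at its right end). -/
def tableauInsert (x : ℕ) : Tableau → Tableau × ℕ
  | [] => ([[x]], 0)
  | r :: rs =>
    match rowInsert x r with
    | (r', none) => (r' :: rs, 0)
    | (r', some y) => (r' :: (tableauInsert y rs).1, (tableauInsert y rs).2 + 1)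

/-- Place `x` at the right end of the row of index `n`. -/
def appendToRow (x : ℕ) : ℕ → Tableau → Tableau
  | 0, [] => [[x]]
  | 0, r :: rs => (r ++ [x]) :: rs
  | _ + 1, [] => []
  | n + 1, r :: rs => r :: appendToRow x n rs

/-- One step of the algorithm on the pair (insertion tableau, recording tableau), for the
column `(i, j)` of the two-line notation. -/
def rsStep (T : Tableau × Tableau) (x : Square) : Tableau × Tableau :=
  ((tableauInsert x.2 T.1).1, appendToRow x.1 (tableauInsert x.2 T.1).2 T.2)

/-- The squares of a placement from left to right: the two-line notation of the associated
partial permutation. -/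
def twoLine (P : Finset Square) : List Square :=
  ((P.map toLex.toEmbedding).sort (· ≤ ·)).map ofLex

/-- The insertion tableau of a placement. -/
def ins (P : Finset Square) : Tableau := ((twoLine P).foldl rsStep ([], [])).1

/-- The recording tableau of a placement. -/
def recT (P : Finset Square) : Tableau := ((twoLine P).foldl rsStep ([], [])).2

end RookGrowth

namespace RookGrowth

/-! Read `P ∩ R` as the word `f` giving the row of the marker in each column, and `φ(P) ∩ R(a, b -
1)` as a word `f'`. Let the smallest occurrence consist of the letters `(c t, r t)`, `1 ≤ t ≤ k`. Up
to column `a = c k` the words agree, except that `f'` has `r (t + 1)` in column `c t` for `t < k`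
and nothing in column `c k`. The marker that `φ` puts at `(a, b)` influences only the corner of `R`.

Insert both words by Robinson–Schensted. The word bumped out of the first row is the skeleton `skel
f` (as in Viennot's shadow construction), so `skel^[n] f` is the word inserted into row `n`. The key
is that the relation between `f` and `f'` passes to their skeletons, with `k` replaced by `k - 1`.
Minimality of the occurrence is used only through the exchange property `IsMinimalDescent`
(`isMinimalDescent_of_min`). It keeps letters out of the boxes between consecutive distinguished
letters, so the two first rows always agree or differ in a single entry. In each phase from `c t` to
`c (t + 1)` there is exactly one column in which the skeletons differ: there `f` bumps `ε t`, and
`f'` bumps `ε (t + 1)`, or nothing in the last phase. This is again a shift (`exists_skelDescent`).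
The exchange property is inherited, because a forbidden chain in the skeleton yields a chain in the
word with one letter more (`noChain_skel`).

The largest value `r 1 = b` and the last column `c k = a` survive each passage. After `k - 1` of
them, the single letter `(a, b)` faces an empty word. Hence (`IsMinimalDescent.iterate_skel`) the
insertion tableaux at time `a` have the same rows apart from the entry `b`, and before time `a` both
words reach the same rows at each step.

The first fact gives the right edge of `R` and the insertion tableaux, the second gives the top edge
and the recording tableaux. The link with growth diagrams is `growth_eq_rowCount`: the partition at
`(i, j)` counts the entries at most `j` in each row after `i` columns, and a local rule is the
effect of one insertion when `j` is raised by one. -/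

/-! ### Inserting a word into a row -/

/-- The entry bumped when `x` (possibly nothing) is inserted into the row with entries `X`. -/
def bump (X : Finset ℕ) : Option ℕ → Option ℕ
  | none => none
  | some z => if h : (X.filter (z < ·)).Nonempty then some ((X.filter (z < ·)).min' h) else none

/-- The entries of the row after the insertion of `x` (possibly nothing). -/
def rowStep (X : Finset ℕ) (x : Option ℕ) : Finset ℕ :=
  X.filter (fun e => bump X x ≠ some e) ∪ x.toFinset

/-- The entries of the first row after the insertion of `f 1, …, f i`. -/
def rowState (f : ℕ → Option ℕ) : ℕ → Finset ℕ
  | 0 => ∅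
  | i + 1 => rowStep (rowState f i) (f (i + 1))

/-- The word of the entries bumped from the first row, that is, inserted into the next one. -/
def skel (f : ℕ → Option ℕ) : ℕ → Option ℕ
  | 0 => none
  | i + 1 => bump (rowState f i) (f (i + 1))

theorem bump_eq_some {X : Finset ℕ} {x : Option ℕ} {v : ℕ} :
    bump X x = some v ↔ ∃ z, x = some z ∧ v ∈ X ∧ z < v ∧ ∀ e ∈ X, z < e → v ≤ e := by
  cases x with
  | none => simp [bump]
  | some z =>
    unfold bump
    simp only [Option.some.injEq, exists_eq_left']
    split_ifs with h
    · rw [Option.some.injEq, Finset.min'_eq_iff]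
      simp only [Finset.mem_filter]
      tauto
    · simp only [false_iff]
      rintro ⟨h1, h2, -⟩
      exact h ⟨v, by simp [h1, h2]⟩

theorem bump_some_eq_none {X : Finset ℕ} {z : ℕ} : bump X (some z) = none ↔ ∀ e ∈ X, e ≤ z := by
  simp only [bump]
  split_ifs with h
  · obtain ⟨x, hx⟩ := h
    simp only [false_iff, not_forall]
    rw [Finset.mem_filter] at hx
    exact ⟨x, hx.1, by omega⟩
  · simp only [true_iff]
    intro e he
    by_contra hlt
    exact h ⟨e, by simp [he]; omega⟩

@[simp] theorem bump_none (X : Finset ℕ) : bump X none = none := rfl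

theorem mem_rowStep {X : Finset ℕ} {x : Option ℕ} {e : ℕ} :
    e ∈ rowStep X x ↔ x = some e ∨ (e ∈ X ∧ bump X x ≠ some e) := by
  simp only [rowStep, Finset.mem_union, Finset.mem_filter, Option.mem_toFinset, Option.mem_def]
  tauto

@[simp] theorem rowStep_none (X : Finset ℕ) : rowStep X none = X := by
  ext e; simp [mem_rowStep]

theorem skel_eq_some {f : ℕ → Option ℕ} {i v : ℕ} :
    skel f i = some v ↔ ∃ j z, i = j + 1 ∧ f i = some z ∧ v ∈ rowState f j ∧ z < v ∧
      ∀ e ∈ rowState f j, z < e → v ≤ e := by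
  cases i with
  | zero => simp [skel]
  | succ i => simp [skel, bump_eq_some]

theorem mem_rowState_succ {f : ℕ → Option ℕ} {i e : ℕ} :
    e ∈ rowState f (i + 1) ↔
      f (i + 1) = some e ∨ (e ∈ rowState f i ∧ skel f (i + 1) ≠ some e) := mem_rowStep

theorem exists_of_mem_rowState {f : ℕ → Option ℕ} {i e : ℕ} (h : e ∈ rowState f i) :
    ∃ s, 1 ≤ s ∧ s ≤ i ∧ f s = some e := by
  induction i with
  | zero => simp [rowState] at h
  | succ i ih =>
    rcases mem_rowState_succ.1 h with h | ⟨h, -⟩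
    · exact ⟨i + 1, by omega, le_rfl, h⟩
    · obtain ⟨s, h1, h2, h3⟩ := ih h
      exact ⟨s, h1, by omega, h3⟩

/-- A word has distinct letters. -/
def WordInj (f : ℕ → Option ℕ) : Prop := ∀ s s' v, f s = some v → f s' = some v → s = s'

theorem not_mem_rowState_of_eq {f : ℕ → Option ℕ} (hf : WordInj f) {i s v : ℕ}
    (h : f s = some v) (hs : i < s) : v ∉ rowState f i := by
  intro hm
  obtain ⟨s', -, h2, h3⟩ := exists_of_mem_rowState hm
  have := hf _ _ _ h h3
  omega

/-- As letters are distinct, an entry enters the row once and, once bumped, never returns; its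
presence is decided by its times of arrival and departure. -/
theorem mem_rowState_iff {f : ℕ → Option ℕ} (hf : WordInj f) {i e : ℕ} :
    e ∈ rowState f i ↔
      (∃ s, 1 ≤ s ∧ s ≤ i ∧ f s = some e) ∧ ∀ s ≤ i, skel f s ≠ some e := by
  induction i with
  | zero =>
    simp only [rowState, Finset.notMem_empty, false_iff, not_and]
    rintro ⟨s, h1, h2, -⟩; omega
  | succ i ih =>
    rw [mem_rowState_succ, ih]
    constructor
    · rintro (h | ⟨⟨⟨s, h1, h2, h3⟩, h4⟩, h5⟩)
      · refine ⟨⟨i + 1, by omega, le_rfl, h⟩, fun s hs hsk => ?_⟩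
        obtain ⟨j, z, rfl, -, h2, -⟩ := skel_eq_some.1 hsk
        exact not_mem_rowState_of_eq hf h (by omega) h2
      · refine ⟨⟨s, h1, by omega, h3⟩, fun s' hs' => ?_⟩
        rcases Nat.lt_or_ge i s' with h | h
        · obtain rfl : s' = i + 1 := by omega
          exact h5
        · exact h4 s' h
    · rintro ⟨⟨s, h1, h2, h3⟩, h4⟩
      rcases Nat.lt_or_ge i s with h | h
      · obtain rfl : s = i + 1 := by omega
        exact Or.inl h3
      · exact Or.inr ⟨⟨⟨s, h1, h, h3⟩, fun s' hs' => h4 s' (by omega)⟩, h4 _ le_rfl⟩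

theorem skel_inj {f : ℕ → Option ℕ} (hf : WordInj f) : WordInj (skel f) := by
  have key : ∀ s s' v, skel f s = some v → skel f s' = some v → ¬ s < s' := by
    intro s s' v h h' hlt
    obtain ⟨j, z, rfl, -, hm, -⟩ := skel_eq_some.1 h'
    exact ((mem_rowState_iff hf).1 hm).2 s (by omega) h
  intro s s' v h h'
  have := key _ _ _ h h'
  have := key _ _ _ h' h
  omega

/-- The letter of the word to the west of a letter of the skeleton. -/
theorem exists_west {f : ℕ → Option ℕ} {i v : ℕ} (h : skel f i = some v) :
    ∃ s, 1 ≤ s ∧ s < i ∧ f s = some v := by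
  obtain ⟨j, z, rfl, -, hm, -⟩ := skel_eq_some.1 h
  obtain ⟨s, h1, h2, h3⟩ := exists_of_mem_rowState hm
  exact ⟨s, h1, by omega, h3⟩

/-- The letter of the word to the south of a letter of the skeleton. -/
theorem exists_south {f : ℕ → Option ℕ} {i v : ℕ} (h : skel f i = some v) :
    ∃ z, z < v ∧ f i = some z := by
  obtain ⟨j, z, rfl, h1, -, h2, -⟩ := skel_eq_some.1 h
  exact ⟨z, h2, h1⟩

/-- Between two letters of the skeleton that form a descent there is a letter of the word. -/
theorem exists_between {f : ℕ → Option ℕ} (hf : WordInj f) {i v i' v' : ℕ} (h : skel f i = some v)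
    (h' : skel f i' = some v') (hi : i < i') (hv : v' < v) :
    (∃ z, z < v ∧ f i = some z ∧ v' ≤ z) ∨
      (∃ z, z < v' ∧ f i = some z ∧ ∃ s, i ≤ s ∧ s < i' ∧ f s = some v') := by
  obtain ⟨j, z, rfl, h1, h2, h3, h4⟩ := skel_eq_some.1 h
  by_cases hz : v' ≤ z
  · exact Or.inl ⟨z, h3, h1, hz⟩
  push Not at hz
  refine Or.inr ⟨z, hz, h1, ?_⟩
  obtain ⟨j', z', rfl, h1', h2', h3', h4'⟩ := skel_eq_some.1 h'
  obtain ⟨s, hs1, hs2, hs3⟩ := exists_of_mem_rowState h2'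
  refine ⟨s, ?_, by omega, hs3⟩
  by_contra hlt
  -- Had `v'` arrived before column `i`, it would still be in the row, since it leaves only in
  -- column `i'`; then `z < v'` would bump an entry at most `v'`, not `v`.
  have hm : v' ∈ rowState f j := by
    rw [mem_rowState_iff hf]
    refine ⟨⟨s, hs1, by omega, hs3⟩, fun s' hs' hk => ?_⟩
    have := skel_inj hf _ _ _ hk h'
    omega
  have := h4 _ hm hz
  omega

/-! ### Rows that differ in one entry -/

/-- The row `X'` arises from `X` by replacing `e` by the smaller number `r`, in the same place. -/
def Differ (X X' : Finset ℕ) (r e : ℕ) : Prop :=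
  e ∈ X ∧ r < e ∧ (∀ x ∈ X, r ≤ x → e ≤ x) ∧ ∀ x, x ∈ X' ↔ x = r ∨ (x ∈ X ∧ x ≠ e)

theorem Differ.bump_eq {X X' : Finset ℕ} {r e : ℕ} (h : Differ X X' r e) :
    bump X (some r) = some e :=
  bump_eq_some.2 ⟨r, rfl, h.1, h.2.1, fun x hx hr => h.2.2.1 x hx hr.le⟩

theorem bump_congr {X X' : Finset ℕ} {x x' : Option ℕ}
    (h : ∀ v, bump X x = some v ↔ bump X' x' = some v) : bump X x = bump X' x' :=
  Option.ext h

/-- No other entry lies between `r` and `e`, so such a `y` lands in the same position of both rows.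
Either that position is not the exceptional one and the difference persists, or the exceptional
entries are both bumped and the rows merge. -/
theorem Differ.step {X X' : Finset ℕ} {r e y : ℕ} (h : Differ X X' r e) (hy : y < r ∨ e < y) :
    (bump X (some y) = bump X' (some y) ∧
        Differ (rowStep X (some y)) (rowStep X' (some y)) r e) ∨
      (y < r ∧ bump X (some y) = some e ∧ bump X' (some y) = some r ∧
        rowStep X (some y) = rowStep X' (some y) ∧
        ∀ x ∈ rowStep X (some y), x ≤ y ∨ r < x) := by
  obtain ⟨h1, h2, h3, h4⟩ := h
  by_cases hb : bump X (some y) = some e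
  · right
    have hb' := bump_eq_some.1 hb
    obtain ⟨z, hz, -, hze, hmin⟩ := hb'
    obtain rfl : y = z := by simpa using hz
    have hyr : y < r := by omega
    have hbr : bump X' (some y) = some r := by
      rw [bump_eq_some]
      refine ⟨y, rfl, (h4 r).2 (Or.inl rfl), hyr, fun x hx hyx => ?_⟩
      rcases (h4 x).1 hx with rfl | ⟨hx, -⟩
      · exact le_rfl
      · have := hmin x hx hyx; omega
    refine ⟨hyr, hb, hbr, ?_, ?_⟩
    · ext x
      rw [mem_rowStep, mem_rowStep, hb, hbr, h4]
      have : r ∉ X := fun hr => by have := h3 r hr le_rfl; omega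
      grind
    · intro x hx
      rw [mem_rowStep, hb] at hx
      rcases hx with hx | ⟨hx, hxe⟩
      · left; simp at hx; omega
      · by_contra hcon
        have := hmin x hx (by omega)
        omega
  · left
    have hbb : bump X (some y) = bump X' (some y) := by
      apply bump_congr
      intro v
      rw [bump_eq_some, bump_eq_some]
      constructor
      · rintro ⟨z, hz, hv, hzv, hmin⟩
        obtain rfl : y = z := by simpa using hz
        have hve : v ≠ e := by
          rintro rfl; exact hb (bump_eq_some.2 ⟨y, rfl, hv, hzv, hmin⟩)
        refine ⟨y, rfl, (h4 v).2 (Or.inr ⟨hv, hve⟩), hzv, fun x hx hyx => ?_⟩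
        rcases (h4 x).1 hx with rfl | ⟨hx, -⟩
        · have := hmin e h1 (by omega)
          by_contra hcon
          have := h3 v hv (by omega)
          omega
        · exact hmin x hx hyx
      · rintro ⟨z, hz, hv, hzv, hmin⟩
        obtain rfl : y = z := by simpa using hz
        rcases (h4 v).1 hv with rfl | ⟨hvX, hve⟩
        · exfalso
          apply hb
          refine bump_eq_some.2 ⟨y, rfl, h1, by omega, fun x hx hyx => ?_⟩
          by_contra hcon
          have h5 := hmin x ((h4 x).2 (Or.inr ⟨hx, by omega⟩)) hyx
          exact hcon (h3 x hx h5)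
        · refine ⟨y, rfl, hvX, hzv, fun x hx hyx => ?_⟩
          by_cases hxe : x = e
          · subst hxe
            rcases hy with hy | hy
            · have := hmin r ((h4 r).2 (Or.inl rfl)) hy; omega
            · omega
          · exact hmin x ((h4 x).2 (Or.inr ⟨hx, hxe⟩)) hyx
    refine ⟨hbb, ?_, h2, ?_, ?_⟩
    · exact mem_rowStep.2 (Or.inr ⟨h1, hb⟩)
    · intro x hx hr
      rcases mem_rowStep.1 hx with hx | ⟨hx, -⟩
      · simp at hx; omega
      · exact h3 x hx hr
    · intro x
      rw [mem_rowStep, mem_rowStep, ← hbb, h4]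
      have hr : bump X (some y) ≠ some r := by
        intro hr
        obtain ⟨z, -, hrX, -⟩ := bump_eq_some.1 hr
        have := h3 r hrX le_rfl
        omega
      grind

/-- Inserting `r` into `X` and `r''` into `X'`. -/
theorem Differ.step_next {X X' : Finset ℕ} {r e r'' : ℕ} (h : Differ X X' r e) (hr : r'' < r)
    (hr'' : r'' ∉ X) :
    ∃ e', bump X' (some r'') = some e' ∧
      Differ (rowStep X (some r)) (rowStep X' (some r'')) r'' e' := by
  have hb := h.bump_eq
  obtain ⟨h1, h2, h3, h4⟩ := h
  -- Since `r` bumps `e`, the first row becomes `X'` itself; it remains to compare `X'` with `X'`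
  -- after the insertion of `r''`.
  have hX : rowStep X (some r) = X' := by
    ext x; rw [mem_rowStep, hb, h4]; grind
  rw [hX]
  have hr' : r ∈ X' := (h4 r).2 (Or.inl rfl)
  obtain ⟨e', he'⟩ : ∃ e', bump X' (some r'') = some e' := by
    rw [← Option.ne_none_iff_exists']
    intro hn
    have := bump_some_eq_none.1 hn r hr'
    omega
  refine ⟨e', he', ?_⟩
  obtain ⟨z, hz, g1, g2, g3⟩ := bump_eq_some.1 he'
  obtain rfl : r'' = z := by simpa using hz
  refine ⟨g1, g2, ?_, ?_⟩
  · intro x hx hrx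
    rcases hrx.eq_or_lt with rfl | hlt
    · rcases (h4 _).1 hx with hx | hx
      · omega
      · exact absurd hx.1 hr''
    · exact g3 x hx hlt
  · intro x; rw [mem_rowStep, he']; grind

/-- Inserting `r` into `X` and the smaller `r''` into `X`, where no entry lies in between. -/
theorem differ_of_gap {X : Finset ℕ} {r r'' : ℕ} (hr : r'' < r)
    (hX : ∀ x ∈ X, x < r'' ∨ r < x) :
    bump X (some r'') = bump X (some r) ∧
      Differ (rowStep X (some r)) (rowStep X (some r'')) r'' r := by
  have hb : bump X (some r'') = bump X (some r) := by
    apply bump_congr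
    intro v
    rw [bump_eq_some, bump_eq_some]
    constructor
    · rintro ⟨z, hz, g1, g2, g3⟩
      obtain rfl : r'' = z := by simpa using hz
      refine ⟨r, rfl, g1, ?_, fun x hx hrx => g3 x hx (by omega)⟩
      rcases hX v g1 with h | h <;> omega
    · rintro ⟨z, hz, g1, g2, g3⟩
      obtain rfl : r = z := by simpa using hz
      refine ⟨r'', rfl, g1, by omega, fun x hx hrx => g3 x hx ?_⟩
      rcases hX x hx with h | h <;> omega
  refine ⟨hb, mem_rowStep.2 (Or.inl rfl), hr, ?_, ?_⟩
  · intro x hx hrx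
    rcases mem_rowStep.1 hx with hx | ⟨hx, -⟩
    · simp at hx; omega
    · rcases hX x hx with h | h <;> omega
  · intro x
    rw [mem_rowStep, mem_rowStep, hb]
    have : r ∉ X := fun h => by rcases hX r h with h | h <;> omega
    grind

/-! ### Least decreasing sequences of maximal length -/

/-- The points `q 0, …, q p` are letters of the word `f` that form a decreasing subsequence. -/
def IsDecreasing (f : ℕ → Option ℕ) (p : ℕ) (q : ℕ → ℕ × ℕ) : Prop :=
  (∀ j ≤ p, f (q j).1 = some (q j).2) ∧
    ∀ j < p, (q j).1 < (q (j + 1)).1 ∧ (q (j + 1)).2 < (q j).2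

/-- The letters `(c t, r t)` of the word `f`, for `1 ≤ t ≤ k`, form a decreasing subsequence that
starts at the largest value, and no segment of it can be replaced by another decreasing sequence
that is longer, or that is as long and lies to the lower left. -/
structure IsMinimalDescent (f : ℕ → Option ℕ) (k : ℕ) (c r : ℕ → ℕ) : Prop where
  inj : WordInj f
  pos : ∀ s v, f s = some v → 1 ≤ s ∧ 1 ≤ v ∧ v ≤ r 1
  col_zero : c 0 = 0
  row_zero : r 0 = r 1 + 1
  row_last : r (k + 1) = 0
  col_lt : ∀ t < k, c t < c (t + 1)
  row_lt : ∀ t ≤ k, r (t + 1) < r t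
  mem : ∀ t, 1 ≤ t → t ≤ k → f (c t) = some (r t)
  noChain : ∀ t p, t + p + 1 ≤ k → ∀ q, IsDecreasing f p q → c t < (q 0).1 → (q 0).2 < r t →
    (q p).1 < c (t + p + 1) → ¬ r (t + p + 2) < (q p).2

/-- The word `f'` arises from `f` by moving the letters `(c t, r t)` to `(c t, r (t + 1))`, and
deleting the last one. -/
structure IsShift (f f' : ℕ → Option ℕ) (k : ℕ) (c r : ℕ → ℕ) : Prop where
  moved : ∀ t, 1 ≤ t → t < k → f' (c t) = some (r (t + 1))
  last : f' (c k) = none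
  fixed : ∀ s ≤ c k, (∀ t, 1 ≤ t → t ≤ k → s ≠ c t) → f' s = f s

/-! ### Comparison of the two first rows, column by column -/

namespace IsMinimalDescent

variable {f f' : ℕ → Option ℕ} {k : ℕ} {c r : ℕ → ℕ}

theorem col_lt_col (h : IsMinimalDescent f k c r) {s t : ℕ} (hst : s < t) (ht : t ≤ k) :
    c s < c t := by
  induction t with
  | zero => omega
  | succ t ih =>
    have := h.col_lt t (by omega)
    rcases Nat.lt_succ_iff_lt_or_eq.1 hst with hs | rfl
    · have := ih hs (by omega); omega
    · exact this

theorem col_le_col (h : IsMinimalDescent f k c r) {s t : ℕ} (hst : s ≤ t) (ht : t ≤ k) :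
    c s ≤ c t := by
  rcases hst.eq_or_lt with rfl | hst
  · exact le_rfl
  · exact (h.col_lt_col hst ht).le

theorem not_col_of_between (h : IsMinimalDescent f k c r) {t s : ℕ} (ht : t < k) (h1 : c t < s)
    (h2 : s < c (t + 1)) : ∀ u, 1 ≤ u → u ≤ k → s ≠ c u := by
  rintro u hu1 hu2 rfl
  rcases Nat.lt_or_ge t u with hlt | hge
  · have := h.col_le_col (s := t + 1) (t := u) hlt hu2; omega
  · have := h.col_le_col (s := u) (t := t) hge ht.le; omega

/-- No letter lies in a box between two consecutive letters of the distinguished sequence. -/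
theorem noPoint (h : IsMinimalDescent f k c r) {t s v : ℕ} (ht : t + 1 ≤ k) (hs : f s = some v)
    (h1 : c t < s) (h2 : s < c (t + 1)) : v ≤ r (t + 2) ∨ r t ≤ v := by
  by_contra hcon
  push Not at hcon
  refine h.noChain t 0 ht (fun _ => (s, v)) ⟨fun _ _ => hs, fun j hj => by omega⟩ h1 hcon.2 h2 ?_
  exact hcon.1

/-- Strictly between `c t` and `c (t + 1)` every letter is below `r (t + 2)` or above `r t`, so
`Differ.step` applies throughout. The rows merge at most once, and after that they stay equal and
have no entry from `r (t + 2)` to `r (t + 1)`. -/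
theorem rowState_phase (h : IsMinimalDescent f k c r) (hf' : IsShift f f' k c r) {t e : ℕ}
    (ht1 : 1 ≤ t) (htk : t < k)
    (hD : Differ (rowState f (c t)) (rowState f' (c t)) (r (t + 1)) e) (he : e ≤ r t)
    (i : ℕ) (hi1 : c t ≤ i) (hi2 : i < c (t + 1)) :
    (Differ (rowState f i) (rowState f' i) (r (t + 1)) e ∧
        ∀ s, c t < s → s ≤ i → skel f' s = skel f s) ∨
      (t + 1 < k ∧ rowState f i = rowState f' i ∧
        (∀ x ∈ rowState f i, x < r (t + 2) ∨ r (t + 1) < x) ∧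
        ∃ τ, c t < τ ∧ τ ≤ i ∧ skel f τ = some e ∧ skel f' τ = some (r (t + 1)) ∧
          ∀ s, c t < s → s ≤ i → s ≠ τ → skel f' s = skel f s) := by
  induction i, hi1 using Nat.le_induction with
  | base => exact Or.inl ⟨hD, fun s h1 h2 => by omega⟩
  | succ i hi1 ih =>
    have hne := h.not_col_of_between htk (s := i + 1) (by omega) hi2
    have hle : i + 1 ≤ c k := hi2.le.trans (h.col_le_col htk le_rfl)
    have heq : f' (i + 1) = f (i + 1) := hf'.fixed _ hle hne
    have hr2 : r (t + 2) < r (t + 1) := h.row_lt (t + 1) htk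
    have hr1 := h.row_lt t htk.le
    -- Equality in `noPoint` is excluded by distinctness of letters; at the end of the descent `r (t
    -- + 2)` is the sentinel `0`, which is no letter.
    have hy : ∀ y, f (i + 1) = some y → y < r (t + 2) ∨ r t < y := by
      intro y hy
      rcases h.noPoint (t := t) (by omega) hy (by omega) hi2 with h5 | h5
      · left
        refine lt_of_le_of_ne h5 ?_
        rintro rfl
        have hpos := h.pos _ _ hy
        rcases Nat.lt_or_ge (t + 1) k with h6 | h6
        · exact hne (t + 2) (by omega) (by omega)
            (h.inj _ _ _ hy (h.mem (t + 2) (by omega) (by omega)))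
        · obtain rfl : k = t + 1 := by omega
          have : r (t + 2) = 0 := h.row_last
          omega
      · right
        refine lt_of_le_of_ne h5 ?_
        rintro rfl
        exact hne t (by omega) (by omega) (h.inj _ _ _ hy (h.mem t (by omega) (by omega)))
    rcases ih (by omega) with ⟨hD, hs⟩ | ⟨hk, hE, hgap, τ, hτ1, hτ2, hτ3, hτ4, hτ5⟩
    · have hs1 : skel f (i + 1) = bump (rowState f i) (f (i + 1)) := rfl
      have hs2 : skel f' (i + 1) = bump (rowState f' i) (f (i + 1)) := by rw [← heq]; rfl
      have hX1 : rowState f (i + 1) = rowStep (rowState f i) (f (i + 1)) := rfl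
      have hX2 : rowState f' (i + 1) = rowStep (rowState f' i) (f (i + 1)) := by rw [← heq]; rfl
      cases hfi : f (i + 1) with
      | none =>
        left
        rw [hfi] at hs1 hs2 hX1 hX2
        simp only [rowStep_none] at hX1 hX2
        rw [hX1, hX2]
        refine ⟨hD, fun s h1 h2 => ?_⟩
        rcases h2.eq_or_lt with rfl | h2
        · rw [hs1, hs2]; rfl
        · exact hs s h1 (by omega)
      | some y =>
        rw [hfi] at hs1 hs2 hX1 hX2
        have hy := hy y hfi
        rcases hD.step (y := y) (by omega) with ⟨hb, hD'⟩ | ⟨h1, h2, h3, h4, h5⟩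
        · left
          rw [hX1, hX2]
          refine ⟨hD', fun s h1 h2 => ?_⟩
          rcases h2.eq_or_lt with rfl | h2
          · rw [hs1, hs2, hb]
          · exact hs s h1 (by omega)
        · right
          have hy2 : y < r (t + 2) := by omega
          -- Merging needs a letter below `r (t + 2)`, which is `0` in the last phase.
          have hk : t + 1 < k := by
            by_contra hk
            obtain rfl : k = t + 1 := by omega
            have : r (t + 2) = 0 := h.row_last
            omega
          refine ⟨hk, by rw [hX1, hX2, h4], ?_, i + 1, by omega, le_rfl, by rw [hs1, h2],
            by rw [hs2, h3], fun s g1 g2 g3 => hs s g1 (by omega)⟩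
          intro x hx
          rw [hX1] at hx
          rcases h5 x hx with h6 | h6
          · left; omega
          · exact Or.inr h6
    · right
      refine ⟨hk, ?_, ?_, τ, hτ1, by omega, hτ3, hτ4, fun s h1 h2 h3 => ?_⟩
      · show rowStep _ _ = rowStep _ _
        rw [hE, heq]
      · intro x hx
        rcases mem_rowState_succ.1 hx with hx | ⟨hx, -⟩
        · rcases hy x hx with h6 | h6
          · exact Or.inl h6
          · right; omega
        · exact hgap x hx
      · rcases h2.eq_or_lt with rfl | h2
        · show bump _ _ = bump _ _
          rw [hE, heq]
        · exact hτ5 s h1 (by omega) h3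

/-- If the rows have not merged, column `c (t + 1)` is the exceptional one: there `f` bumps `e`, and
`f'` bumps the `e'` at which the rows differ next. If they merged in an earlier column `τ`, then
`f'` bumped `r (t + 1)` there; by the gap, both words bump the same in column `c (t + 1)`, after
which the rows differ in exactly this entry, so `e' = r (t + 1)`. In the last phase `f'` inserts
nothing and the rows become equal. -/
theorem skel_phase (h : IsMinimalDescent f k c r) (hf' : IsShift f f' k c r) {t e : ℕ}
    (ht1 : 1 ≤ t) (htk : t < k)
    (hD : Differ (rowState f (c t)) (rowState f' (c t)) (r (t + 1)) e) (he : e ≤ r t) :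
    ∃ τ, c t < τ ∧ τ ≤ c (t + 1) ∧ (t + 1 = k → τ = c (t + 1)) ∧ skel f τ = some e ∧
      (∀ s, c t < s → s ≤ c (t + 1) → s ≠ τ → skel f' s = skel f s) ∧
      (t + 1 < k → ∃ e', skel f' τ = some e' ∧
        Differ (rowState f (c (t + 1))) (rowState f' (c (t + 1))) (r (t + 2)) e') ∧
      (t + 1 = k → skel f' τ = none ∧ rowState f (c (t + 1)) = rowState f' (c (t + 1))) := by
  have hc := h.col_lt t htk
  obtain ⟨i, hi⟩ : ∃ i, c (t + 1) = i + 1 := ⟨c (t + 1) - 1, by omega⟩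
  have hph := h.rowState_phase hf' ht1 htk hD he i (by omega) (by omega)
  have hfi : f (i + 1) = some (r (t + 1)) := by rw [← hi]; exact h.mem _ (by omega) (by omega)
  have hr2 : r (t + 2) < r (t + 1) := h.row_lt (t + 1) htk
  have hs1 : skel f (i + 1) = bump (rowState f i) (some (r (t + 1))) := by rw [← hfi]; rfl
  have hX1 : rowState f (i + 1) = rowStep (rowState f i) (some (r (t + 1))) := by rw [← hfi]; rfl
  rcases Nat.lt_or_ge (t + 1) k with hk | hk
  · have hfi' : f' (i + 1) = some (r (t + 2)) := by
      rw [← hi]; exact hf'.moved (t + 1) (by omega) hk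
    have hs2 : skel f' (i + 1) = bump (rowState f' i) (some (r (t + 2))) := by rw [← hfi']; rfl
    have hX2 : rowState f' (i + 1) = rowStep (rowState f' i) (some (r (t + 2))) := by
      rw [← hfi']; rfl
    rw [hi, hX1, hX2]
    rcases hph with ⟨hD, hs⟩ | ⟨-, hE, hgap, τ, hτ1, hτ2, hτ3, hτ4, hτ5⟩
    · obtain ⟨e', he', hD'⟩ := hD.step_next hr2 (not_mem_rowState_of_eq h.inj
        (h.mem (t + 2) (by omega) (by omega))
        (by have : c (t + 1) < c (t + 2) := h.col_lt (t + 1) hk; omega))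
      refine ⟨i + 1, by omega, le_rfl, fun _ => rfl, by rw [hs1, hD.bump_eq], ?_, ?_, by omega⟩
      · exact fun s h1 h2 h3 => hs s h1 (by omega)
      · exact fun _ => ⟨e', by rw [hs2, he'], hD'⟩
    · obtain ⟨hb, hD'⟩ := differ_of_gap hr2 hgap
      refine ⟨τ, hτ1, by omega, by omega, hτ3, ?_, fun _ => ⟨_, hτ4, ?_⟩, by omega⟩
      · intro s h1 h2 h3
        rcases h2.eq_or_lt with rfl | h2
        · rw [hs1, hs2, ← hb, hE]
        · exact hτ5 s h1 (by omega) h3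
      · rw [← hE]; exact hD'
  · obtain rfl : k = t + 1 := by omega
    rcases hph with ⟨hD, hs⟩ | ⟨hk, -⟩
    · have hfi' : f' (i + 1) = none := by rw [← hi]; exact hf'.last
      have hs2 : skel f' (i + 1) = bump (rowState f' i) none := by rw [← hfi']; rfl
      have hX2 : rowState f' (i + 1) = rowStep (rowState f' i) none := by rw [← hfi']; rfl
      rw [hi, hX1, hX2]
      refine ⟨i + 1, by omega, le_rfl, fun _ => rfl, by rw [hs1, hD.bump_eq], ?_, by omega,
        fun _ => ⟨by rw [hs2]; rfl, ?_⟩⟩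
      · exact fun s h1 h2 h3 => hs s h1 (by omega)
      · ext x
        rw [rowStep_none, hD.2.2.2, mem_rowStep, hD.bump_eq]
        grind
    · omega

/-- Before the first letter of the distinguished sequence both words agree. -/
theorem rowState_eq_of_lt (h : IsMinimalDescent f k c r) (hf' : IsShift f f' k c r) (hk : 1 ≤ k)
    (i : ℕ) (hi : i < c 1) :
    rowState f i = rowState f' i ∧ ∀ s ≤ i, skel f' s = skel f s := by
  induction i with
  | zero =>
    refine ⟨rfl, fun s hs => ?_⟩
    obtain rfl : s = 0 := by omega
    rfl
  | succ i ih =>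
    obtain ⟨h1, h2⟩ := ih (by omega)
    have hne := h.not_col_of_between (t := 0) (s := i + 1) hk (by rw [h.col_zero]; omega) hi
    have hle : i + 1 ≤ c k := hi.le.trans (h.col_le_col hk le_rfl)
    have heq : f' (i + 1) = f (i + 1) := hf'.fixed _ hle hne
    refine ⟨?_, fun s hs => ?_⟩
    · show rowStep _ _ = rowStep _ _
      rw [h1, heq]
    · rcases hs.eq_or_lt with rfl | hs
      · show bump _ _ = bump _ _
        rw [h1, heq]
      · exact h2 s (by omega)

/-- No letter before `c 1` lies from `r 2` to `r 1`, so `r 1` and `r 2` are placed in the same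
position of a common row. -/
theorem differ_first (h : IsMinimalDescent f k c r) (hf' : IsShift f f' k c r) (hk : 2 ≤ k) :
    Differ (rowState f (c 1)) (rowState f' (c 1)) (r 2) (r 1) ∧
      ∀ s ≤ c 1, skel f' s = skel f s := by
  have hc := h.col_lt 0 (by omega)
  obtain ⟨i, hi⟩ : ∃ i, c 1 = i + 1 := ⟨c 1 - 1, by simp at hc; omega⟩
  obtain ⟨hE, hs⟩ := h.rowState_eq_of_lt hf' (by omega) i (by omega)
  have hfi : f (i + 1) = some (r 1) := by rw [← hi]; exact h.mem _ (by omega) (by omega)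
  have hfi' : f' (i + 1) = some (r 2) := by rw [← hi]; exact hf'.moved 1 (by omega) (by omega)
  have hgap : ∀ x ∈ rowState f i, x < r 2 ∨ r 1 < x := by
    intro x hx
    obtain ⟨s, hs1, hs2, hs3⟩ := exists_of_mem_rowState hx
    have hc2 := h.col_lt 1 (by omega)
    rcases h.noPoint (t := 0) (by omega) hs3 (by rw [h.col_zero]; omega) (by simp; omega) with
      h5 | h5
    · left
      refine lt_of_le_of_ne h5 ?_
      rintro rfl
      have := h.inj _ _ _ hs3 (h.mem 2 (by omega) hk)
      simp at hc2
      omega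
    · rw [h.row_zero] at h5
      exact Or.inr h5
  obtain ⟨hb, hD⟩ := differ_of_gap (h.row_lt 1 (by omega)) hgap
  have hX1 : rowState f (i + 1) = rowStep (rowState f i) (some (r 1)) := by rw [← hfi]; rfl
  have hX2 : rowState f' (i + 1) = rowStep (rowState f' i) (some (r 2)) := by rw [← hfi']; rfl
  rw [hi, hX1, hX2, ← hE]
  refine ⟨hD, fun s h2 => ?_⟩
  rcases h2.eq_or_lt with rfl | h2
  · show bump _ _ = bump _ _
    rw [hfi, hfi', ← hE]
    exact hb
  · exact hs s (by omega)

end IsMinimalDescent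

/-- The letters `(τ t, ε t)` of the skeleton of `f` that the distinguished letters `(c t, r t)` of
`f` give rise to. -/
structure IsSkelDescent (f : ℕ → Option ℕ) (k : ℕ) (c r τ ε : ℕ → ℕ) : Prop where
  col_zero : τ 0 = 0
  row_zero : ε 0 = ε 1 + 1
  row_one : ε 1 = r 1
  row_last : ε (k + 1) = 0
  col_last : τ k = c (k + 1)
  lt_col : ∀ t, 1 ≤ t → t ≤ k → c t < τ t
  col_le : ∀ t, 1 ≤ t → t ≤ k → τ t ≤ c (t + 1)
  lt_row : ∀ t, 1 ≤ t → t ≤ k → r (t + 1) < ε t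
  row_le : ∀ t, 1 ≤ t → t ≤ k → ε t ≤ r t
  skel_eq : ∀ t, 1 ≤ t → t ≤ k → skel f (τ t) = some (ε t)
  mem_row : ∀ t, 1 ≤ t → t ≤ k → ε t ∈ rowState f (c t)
  min_row : ∀ t, 1 ≤ t → t ≤ k → ∀ x ∈ rowState f (c t), r (t + 1) ≤ x → ε t ≤ x

/-! ### Passage from a word to its skeleton -/

namespace IsMinimalDescent

variable {f f' : ℕ → Option ℕ} {k : ℕ} {c r τ ε : ℕ → ℕ}

theorem mem_rowState_col (h : IsMinimalDescent f k c r) {t : ℕ} (ht1 : 1 ≤ t) (htk : t ≤ k) :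
    r t ∈ rowState f (c t) := by
  have hm := h.mem t ht1 htk
  have hc := h.pos _ _ hm
  obtain ⟨i, hi⟩ : ∃ i, c t = i + 1 := ⟨c t - 1, by omega⟩
  rw [hi] at hm ⊢
  exact mem_rowState_succ.2 (Or.inl hm)

/-- The phases are chained: the entry `e'` produced by one phase is the entry `e` of the next, so
`f'` bumps in column `τ t` what `f` bumps in column `τ (t + 1)`. -/
theorem exists_skelDescent (h : IsMinimalDescent f (k + 1) c r) (hf' : IsShift f f' (k + 1) c r)
    (hk : 1 ≤ k) :
    ∃ τ ε, IsSkelDescent f k c r τ ε ∧ IsShift (skel f) (skel f') k τ ε ∧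
      rowState f (c (k + 1)) = rowState f' (c (k + 1)) := by
  -- By `Differ.bump_eq` the exceptional entry depends on the first word alone, so it can be named
  -- in advance; the default `0` is not used for `1 ≤ t ≤ k`.
  obtain ⟨e, he⟩ : ∃ e : ℕ → ℕ, ∀ t, e t = (bump (rowState f (c t)) (some (r (t + 1)))).getD 0 :=
    ⟨_, fun _ => rfl⟩
  have hed : ∀ {t x X'}, Differ (rowState f (c t)) X' (r (t + 1)) x → x = e t := by
    intro t x X' hx
    rw [he, hx.bump_eq]; rfl
  have hle : ∀ {t X' x}, 1 ≤ t → t ≤ k → Differ (rowState f (c t)) X' (r (t + 1)) x → x ≤ r t := by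
    intro t X' x h1 h2 hx
    exact hx.2.2.1 _ (h.mem_rowState_col h1 (by omega)) (h.row_lt t (by omega)).le
  obtain ⟨hD1, hs1⟩ := h.differ_first hf' (by omega)
  have he1 : r 1 = e 1 := hed hD1
  have hD : ∀ t, 1 ≤ t → t ≤ k →
      Differ (rowState f (c t)) (rowState f' (c t)) (r (t + 1)) (e t) := by
    intro t ht1
    induction t, ht1 using Nat.le_induction with
    | base => intro _; rw [← he1]; exact hD1
    | succ t ht1 ih =>
      intro htk
      have hDt := ih (by omega)
      obtain ⟨_, -, -, -, -, -, h6, -⟩ :=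
        h.skel_phase hf' ht1 (by omega) hDt (hle ht1 (by omega) hDt)
      obtain ⟨e', -, he'⟩ := h6 (by omega)
      rw [← hed he']
      exact he'
  have hph : ∀ t, ∃ τ, 1 ≤ t → t ≤ k → c t < τ ∧ τ ≤ c (t + 1) ∧ (t = k → τ = c (t + 1)) ∧
      skel f τ = some (e t) ∧
      (∀ s, c t < s → s ≤ c (t + 1) → s ≠ τ → skel f' s = skel f s) ∧
      (t < k → skel f' τ = some (e (t + 1))) ∧
      (t = k → skel f' τ = none ∧ rowState f (c (t + 1)) = rowState f' (c (t + 1))) := by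
    intro t
    by_cases ht : 1 ≤ t ∧ t ≤ k
    · have hDt := hD t ht.1 ht.2
      obtain ⟨τ, h1, h2, h3, h4, h5, h6, h7⟩ :=
        h.skel_phase hf' ht.1 (by omega) hDt (hle ht.1 ht.2 hDt)
      refine ⟨τ, fun _ _ => ⟨h1, h2, fun h => h3 (by omega), h4, h5, fun htk => ?_,
        fun h => h7 (by omega)⟩⟩
      obtain ⟨e', h8, h9⟩ := h6 (by omega)
      rw [h8, hed h9]
    · exact ⟨0, fun h1 h2 => absurd ⟨h1, h2⟩ ht⟩
  choose τ hτ using hph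
  refine ⟨fun t => if t = 0 then 0 else τ t,
    fun t => if t = 0 then r 1 + 1 else if t ≤ k then e t else 0, ?_, ?_,
    ((hτ k hk le_rfl).2.2.2.2.2.2 rfl).2⟩
  · constructor
    · simp
    · simp [hk, he1]
    · simp [hk, he1]
    · simp
    · simp only [show k ≠ 0 by omega, if_false]
      exact (hτ k hk le_rfl).2.2.1 rfl
    all_goals
      intro t ht1 htk
      simp only [show t ≠ 0 by omega, if_false, htk, if_true]
    · exact (hτ t ht1 htk).1
    · exact (hτ t ht1 htk).2.1
    · exact (hD t ht1 htk).2.1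
    · exact hle ht1 htk (hD t ht1 htk)
    · exact (hτ t ht1 htk).2.2.2.1
    · exact (hD t ht1 htk).1
    · exact (hD t ht1 htk).2.2.1
  · constructor
    · intro t ht1 htk
      have h8 : t + 1 ≤ k := htk
      simp only [show t ≠ 0 by omega, if_false, h8, if_true, show t + 1 ≠ 0 by omega]
      exact (hτ t ht1 htk.le).2.2.2.2.2.1 htk
    · simp only [show k ≠ 0 by omega, if_false]
      exact ((hτ k hk le_rfl).2.2.2.2.2.2 rfl).1
    · intro s hs hne
      simp only [show k ≠ 0 by omega, if_false] at hs
      rw [(hτ k hk le_rfl).2.2.1 rfl] at hs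
      -- Each column up to `c (k + 1)` lies in the initial stretch or in exactly one phase.
      have hex : ∀ t, 1 ≤ t → t ≤ k + 1 → s ≤ c t →
          s ≤ c 1 ∨ ∃ u, 1 ≤ u ∧ u ≤ k ∧ c u < s ∧ s ≤ c (u + 1) := by
        intro t ht1
        induction t, ht1 using Nat.le_induction with
        | base => intro _ h; exact Or.inl h
        | succ t ht1 ih =>
          intro htk hst
          rcases Nat.lt_or_ge (c t) s with h1 | h1
          · exact Or.inr ⟨t, ht1, by omega, h1, hst⟩
          · exact ih (by omega) h1
      rcases hex (k + 1) (by omega) le_rfl hs with h1 | ⟨u, hu1, hu2, hu3, hu4⟩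
      · exact hs1 s h1
      · refine (hτ u hu1 hu2).2.2.2.2.1 s hu3 hu4 ?_
        have := hne u hu1 hu2
        simpa only [show u ≠ 0 by omega, if_false] using this

/-- A decreasing sequence of letters of the skeleton, between two distinguished letters, gives a
decreasing sequence of letters of the word with one letter more. -/
theorem noChain_skel (h : IsMinimalDescent f (k + 1) c r) (hs : IsSkelDescent f k c r τ ε)
    (t p : ℕ) (htp : t + p + 1 ≤ k) (q : ℕ → ℕ × ℕ) (hq : IsDecreasing (skel f) p q)
    (h1 : τ t < (q 0).1) (h2 : (q 0).2 < ε t) (h3 : (q p).1 < τ (t + p + 1)) :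
    ¬ ε (t + p + 2) < (q p).2 := by
  intro h4
  have hsq := hq.1
  -- the first letter
  have hfirst : ∃ m : ℕ × ℕ, f m.1 = some m.2 ∧ c t < m.1 ∧ m.2 < r t ∧ m.1 ≤ (q 0).1 ∧
      (q 0).2 ≤ m.2 ∧ (m.1 = (q 0).1 → m.2 < (q 0).2) := by
    rcases Nat.eq_zero_or_pos t with rfl | ht
    · obtain ⟨s, hs1, hs2, hs3⟩ := exists_west (hsq 0 (by omega))
      have := (h.pos _ _ hs3).2.2
      exact ⟨(s, (q 0).2), hs3, by rw [h.col_zero]; exact hs1, by rw [h.row_zero]; simp; omega,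
        hs2.le, le_rfl, fun h => by simp at h; omega⟩
    · have hc := hs.lt_col t ht (by omega)
      have hr := hs.row_le t ht (by omega)
      have key := exists_between h.inj (hs.skel_eq t ht (by omega)) (hsq 0 (by omega)) h1 h2
      rcases key with ⟨z, hz1, hz2, hz3⟩ | ⟨z, -, -, s, hs1, hs2, hs3⟩
      · exact ⟨(τ t, z), hz2, hc, by simp; omega, h1.le, hz3, fun h => by simp at h; omega⟩
      · exact ⟨(s, (q 0).2), hs3, by simp; omega, by simp; omega, hs2.le, le_rfl,
          fun h => by simp at h; omega⟩
  -- the letters in the middle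
  have hmid : ∀ j, ∃ m : ℕ × ℕ, j < p → f m.1 = some m.2 ∧
      (q j).1 ≤ m.1 ∧ m.2 < (q j).2 ∧ m.1 ≤ (q (j + 1)).1 ∧ (q (j + 1)).2 ≤ m.2 ∧
      (m.1 = (q (j + 1)).1 → m.2 < (q (j + 1)).2) := by
    intro j
    by_cases hj : j < p
    · obtain ⟨g1, g2⟩ := hq.2 j hj
      rcases exists_between h.inj (hsq j hj.le) (hsq (j + 1) hj) g1 g2 with
        ⟨z, hz1, hz2, hz3⟩ | ⟨z, -, -, s, hs1, hs2, hs3⟩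
      · exact ⟨((q j).1, z), fun _ => ⟨hz2, le_rfl, hz1, g1.le, hz3, fun h => by simp at h; omega⟩⟩
      · exact ⟨(s, (q (j + 1)).2), fun _ => ⟨hs3, hs1, g2, hs2.le, le_rfl,
          fun h => by simp at h; omega⟩⟩
    · exact ⟨0, fun h => absurd h hj⟩
  obtain ⟨m0, a1, a2, a3, a4, a5, a6⟩ := hfirst
  choose md hmd using hmid
  -- the letters but the last
  obtain ⟨M, hM⟩ : ∃ M : ℕ → ℕ × ℕ, ∀ j, M j = if j = 0 then m0 else md (j - 1) := ⟨_, fun _ => rfl⟩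
  have hM0 : M 0 = m0 := by simp [hM]
  have hMs : ∀ j, M (j + 1) = md j := fun j => by simp [hM]
  have hMf : ∀ j ≤ p, f (M j).1 = some (M j).2 := by
    intro j hj
    cases j with
    | zero => rw [hM0]; exact a1
    | succ j => rw [hMs]; exact (hmd j hj).1
  have hMq : ∀ j ≤ p, (M j).1 < (q j).1 ∧ (q j).2 ≤ (M j).2 := by
    intro j hj
    have haux : (M j).1 ≤ (q j).1 ∧ (q j).2 ≤ (M j).2 ∧
        ((M j).1 = (q j).1 → (M j).2 < (q j).2) := by
      cases j with
      | zero => rw [hM0]; exact ⟨a4, a5, a6⟩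
      | succ j => rw [hMs]; exact (hmd j hj).2.2.2
    obtain ⟨b1, b2, b3⟩ := haux
    exact ⟨lt_of_le_of_ne b1 fun h => by have := b3 h; omega, b2⟩
  have hMdec : IsDecreasing f p M := by
    refine ⟨hMf, fun j hj => ?_⟩
    obtain ⟨b1, b2⟩ := hMq j hj.le
    obtain ⟨-, d1, d2, -⟩ := hmd j hj
    rw [hMs]
    exact ⟨by omega, by omega⟩
  obtain ⟨b1, b2⟩ := hMq p le_rfl
  -- a suitable last letter gives a contradiction
  have hlast : ∀ m : ℕ × ℕ, f m.1 = some m.2 → (q p).1 ≤ m.1 → m.2 < (q p).2 →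
      m.1 < c (t + p + 2) → r (t + p + 3) < m.2 → False := by
    intro m g1 g2 g3 g4 g5
    refine h.noChain t (p + 1) (by omega) (fun j => if j ≤ p then M j else m) ⟨?_, ?_⟩ ?_ ?_ ?_ ?_
    · intro j hj
      by_cases hjp : j ≤ p
      · simp only [hjp, if_true]; exact hMf j hjp
      · simp only [hjp, if_false]; exact g1
    · intro j hj
      rcases Nat.lt_or_ge j p with hjp | hjp
      · simp only [hjp.le, if_true, show j + 1 ≤ p from hjp]
        exact hMdec.2 j hjp
      · obtain rfl : j = p := by omega
        simp only [le_rfl, if_true, show ¬ j + 1 ≤ j by omega, if_false]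
        exact ⟨by omega, by omega⟩
    · simp only [Nat.zero_le, if_true, hM0]; exact a2
    · simp only [Nat.zero_le, if_true, hM0]; exact a3
    · simp only [show ¬ p + 1 ≤ p by omega, if_false]
      exact g4
    · simp only [show ¬ p + 1 ≤ p by omega, if_false]
      exact g5
  have hqτ : (q p).1 < c (t + p + 2) := lt_of_lt_of_le h3 (hs.col_le (t + p + 1) (by omega) htp)
  rcases htp.eq_or_lt with hk | hk
  -- After the last distinguished skeleton letter, the lower bound is the sentinel `r (k + 2) = 0`,
  -- so the letter south of `q p` serves.
  · obtain ⟨z, hz1, hz2⟩ := exists_south (hsq p le_rfl)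
    refine hlast ((q p).1, z) hz2 le_rfl hz1 hqτ ?_
    have h5 : r (t + p + 3) = 0 := by rw [← h.row_last, ← hk]
    have := (h.pos _ _ hz2).2.1
    simp; omega
  · have hlt_row : r (t + p + 3) < ε (t + p + 2) := hs.lt_row (t + p + 2) (by omega) hk
    have hττ : (q p).1 < τ (t + p + 2) :=
      hqτ.trans (hs.lt_col (t + p + 2) (by omega) hk)
    rcases exists_between h.inj (hsq p le_rfl) (hs.skel_eq (t + p + 2) (by omega) hk) hττ h4 with
      ⟨z, hz1, hz2, hz3⟩ | ⟨z, hz1, hz2, s, hs1, hs2, hs3⟩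
    · exact hlast ((q p).1, z) hz2 le_rfl hz1 hqτ (by simp; omega)
    · obtain ⟨s', hs1', hs2', hs3'⟩ :=
        exists_of_mem_rowState (hs.mem_row (t + p + 2) (by omega) hk)
      obtain rfl := h.inj _ _ _ hs3 hs3'
      rcases hs2'.lt_or_eq with hlt | heq
      · exact hlast (s, ε (t + p + 2)) hs3 hs1 h4 hlt hlt_row
      -- The exceptional case: the candidate for the last letter is the distinguished letter itself,
      -- which is not strictly left of `c (t + p + 2)`. The chain `M` without it already violates
      -- `noChain` unless it reaches column `c (t + p + 1)`.
      · have hεr : ε (t + p + 2) = r (t + p + 2) := by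
          rw [heq, h.mem _ (by omega) (by omega)] at hs3
          exact (Option.some.inj hs3).symm
        have hMr : r (t + p + 2) < (M p).2 := by omega
        have hcM : c (t + p + 1) ≤ (M p).1 := by
          by_contra hcon
          exact h.noChain t p (by omega) M hMdec (by rw [hM0]; exact a2) (by rw [hM0]; exact a3)
            (by omega) hMr
        -- the entry `(q p).2` is bumped while `ε (t + p + 1)` is in the row
        have hT1 : 1 ≤ t + p + 1 := by omega
        have hεT := hs.mem_row (t + p + 1) hT1 htp
        have hεr1 : r (t + p + 2) < ε (t + p + 1) := hs.lt_row (t + p + 1) hT1 htp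
        obtain ⟨j, z', hj, hz', hqm, hzq, hmin⟩ := skel_eq_some.1 (hsq p le_rfl)
        obtain rfl : z = z' := by rw [hz2] at hz'; exact Option.some.inj hz'
        have hτT := hs.skel_eq (t + p + 1) hT1 htp
        have hεj : ε (t + p + 1) ∈ rowState f j := by
          obtain ⟨⟨s, e1, e2, e3⟩, e4⟩ := (mem_rowState_iff h.inj).1 hεT
          refine (mem_rowState_iff h.inj).2 ⟨⟨s, e1, by omega, e3⟩, fun s' hs' hk => ?_⟩
          have := skel_inj h.inj _ _ _ hk hτT
          omega
        have hle := hmin _ hεj (by omega)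
        have hne : (q p).2 ≠ ε (t + p + 1) := by
          intro hcon
          have h6 := hsq p le_rfl
          rw [hcon] at h6
          have := skel_inj h.inj _ _ _ h6 hτT
          omega
        obtain ⟨s, e1, e2, e3⟩ := exists_of_mem_rowState hqm
        have hsk := hsq p le_rfl
        -- The value `(q p).2` lies strictly between `r (t + p + 2)` and `ε (t + p + 1)`. Arriving
        -- after column `c (t + p + 1)` it violates `noPoint`; arriving earlier it violates the
        -- minimality of `ε (t + p + 1)` in the row.
        rcases Nat.lt_or_ge (c (t + p + 1)) s with hcs | hcs
        · rcases h.noPoint (t := t + p + 1) (by omega) e3 hcs (by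
            show s < c (t + p + 2); omega) with h6 | h6
          · have h7 : r (t + p + 3) < r (t + p + 2) := h.row_lt (t + p + 2) (by omega)
            have h8 : (q p).2 ≤ r (t + p + 3) := h6
            omega
          · have := hs.row_le (t + p + 1) hT1 htp
            omega
        · have hqc : (q p).2 ∈ rowState f (c (t + p + 1)) := by
            refine (mem_rowState_iff h.inj).2 ⟨⟨s, e1, hcs, e3⟩, fun s' hs' hk => ?_⟩
            have := skel_inj h.inj _ _ _ hk hsk
            omega
          have := hs.min_row (t + p + 1) hT1 htp _ hqc (by
            show r (t + p + 2) ≤ _; omega)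
          omega

theorem skel_isMinimalDescent (h : IsMinimalDescent f (k + 1) c r)
    (hs : IsSkelDescent f k c r τ ε) : IsMinimalDescent (skel f) k τ ε where
  inj := skel_inj h.inj
  pos := by
    intro s v hv
    obtain ⟨s', h1, h2, h3⟩ := exists_west hv
    have := h.pos _ _ h3
    rw [hs.row_one]
    omega
  col_zero := hs.col_zero
  row_zero := hs.row_zero
  row_last := hs.row_last
  col_lt := by
    intro t ht
    have h1 := hs.lt_col (t + 1) (by omega) ht
    rcases Nat.eq_zero_or_pos t with rfl | h0
    · rw [hs.col_zero]; omega
    · have := hs.col_le t h0 ht.le; omega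
  row_lt := by
    intro t ht
    rcases Nat.eq_zero_or_pos t with rfl | h0
    · rw [hs.row_zero]; simp
    · have h1 := hs.lt_row t h0 ht
      rcases ht.eq_or_lt with rfl | ht
      · rw [hs.row_last]; omega
      · have := hs.row_le (t + 1) (by omega) ht; omega
  mem := hs.skel_eq
  noChain := h.noChain_skel hs

theorem isSome_eq (h : IsMinimalDescent f k c r) (hf' : IsShift f f' k c r) {s : ℕ}
    (hs : s < c k) : (f s).isSome = (f' s).isSome := by
  by_cases hex : ∃ t, 1 ≤ t ∧ t ≤ k ∧ s = c t
  · obtain ⟨t, h1, h2, rfl⟩ := hex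
    have htk : t < k := lt_of_le_of_ne h2 (by rintro rfl; omega)
    rw [h.mem t h1 h2, hf'.moved t h1 htk]
    rfl
  · push Not at hex
    rw [hf'.fixed s hs.le hex]

/-- For `k = 1` the forbidden box of `noPoint` consists of all columns left of `c 1`. This ends the
recursion over the rows. -/
theorem eq_none_of_lt (h : IsMinimalDescent f 1 c r) {s : ℕ} (hs : s < c 1) : f s = none := by
  rw [Option.eq_none_iff_forall_ne_some]
  intro v hv
  have hp := h.pos _ _ hv
  have h2 : r 2 = 0 := h.row_last
  rcases h.noPoint (t := 0) le_rfl hv (by rw [h.col_zero]; omega) hs with h5 | h5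
  · simp [h2] at h5; omega
  · rw [h.row_zero] at h5; omega

end IsMinimalDescent

/-! ### Iteration over all rows of the tableau -/

theorem rowState_eq_empty {f : ℕ → Option ℕ} {a : ℕ} (hf : ∀ s ≤ a, f s = none) :
    ∀ i ≤ a, rowState f i = ∅ := by
  intro i hi
  rw [Finset.eq_empty_iff_forall_notMem]
  intro e he
  obtain ⟨s, -, h2, h3⟩ := exists_of_mem_rowState he
  rw [hf s (by omega)] at h3
  cases h3

theorem skel_eq_none {f : ℕ → Option ℕ} {a : ℕ} (hf : ∀ s < a, f s = none) :
    ∀ s ≤ a, skel f s = none := by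
  intro s hs
  rw [Option.eq_none_iff_forall_ne_some]
  intro v hv
  obtain ⟨s', -, h2, h3⟩ := exists_west hv
  rw [hf s' (by omega)] at h3
  cases h3

theorem iterate_skel_eq_none {f : ℕ → Option ℕ} {a : ℕ} (hf : ∀ s ≤ a, f s = none) (n : ℕ) :
    ∀ s ≤ a, skel^[n] f s = none := by
  induction n generalizing f with
  | zero => exact hf
  | succ n ih => exact ih (skel_eq_none fun s hs => hf s hs.le)

/-- In all rows of the insertion tableau, the words differ by shifts only. -/
theorem IsMinimalDescent.iterate_skel {f f' : ℕ → Option ℕ} {k : ℕ} {c r : ℕ → ℕ} (hk : 1 ≤ k)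
    (h : IsMinimalDescent f k c r) (hf' : IsShift f f' k c r) (n : ℕ) :
    (rowState (skel^[n] f) (c k)).erase (r 1) = (rowState (skel^[n] f') (c k)).erase (r 1) ∧
      ∀ s < c k, (skel^[n] f s).isSome = (skel^[n] f' s).isSome := by
  induction n generalizing f f' k c r with
  | zero =>
    refine ⟨?_, fun s hs => h.isSome_eq hf' hs⟩
    rcases hk.eq_or_lt with rfl | hk
    · ext x
      simp only [Function.iterate_zero, id_eq, Finset.mem_erase, and_congr_right_iff]
      intro hx
      constructor <;> intro hm <;> obtain ⟨s, h1, h2, h3⟩ := exists_of_mem_rowState hm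
      · exfalso
        rcases h2.lt_or_eq with h2 | rfl
        · rw [h.eq_none_of_lt h2] at h3; cases h3
        · rw [h.mem 1 le_rfl le_rfl] at h3
          exact hx (Option.some.inj h3).symm
      · exfalso
        rcases h2.lt_or_eq with h2 | rfl
        · have := h.isSome_eq hf' h2
          rw [h.eq_none_of_lt h2, h3] at this
          cases this
        · rw [hf'.last] at h3; cases h3
    · obtain ⟨k, rfl⟩ : ∃ l, k = l + 1 := ⟨k - 1, by omega⟩
      obtain ⟨τ, ε, -, -, h3⟩ := h.exists_skelDescent hf' (by omega)
      simp only [Function.iterate_zero, id_eq, h3]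
  | succ n ih =>
    rw [Function.iterate_succ_apply, Function.iterate_succ_apply]
    rcases hk.eq_or_lt with rfl | hk
    · have h1 := iterate_skel_eq_none (skel_eq_none fun s hs => h.eq_none_of_lt hs) n
      have hf'n : ∀ s < c 1, f' s = none := by
        intro s hs
        have := h.isSome_eq hf' hs
        rw [h.eq_none_of_lt hs] at this
        simpa using this.symm
      have h2 := iterate_skel_eq_none (skel_eq_none hf'n) n
      refine ⟨?_, fun s hs => by rw [h1 s hs.le, h2 s hs.le]⟩
      rw [rowState_eq_empty h1 _ le_rfl, rowState_eq_empty h2 _ le_rfl]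
    · obtain ⟨k, rfl⟩ : ∃ l, k = l + 1 := ⟨k - 1, by omega⟩
      obtain ⟨τ, ε, hs, hsh, -⟩ := h.exists_skelDescent hf' (by omega)
      have := ih (by omega) (h.skel_isMinimalDescent hs) hsh
      rw [hs.col_last, hs.row_one] at this
      exact this

/-! ### Restriction to small values -/

/-- The word `f` without the letters that exceed `j`. -/
def cut (j : ℕ) (f : ℕ → Option ℕ) (i : ℕ) : Option ℕ := (f i).filter (fun v => decide (v ≤ j))

/-- A letter bumps only larger entries, and the least of them; entries above `j` therefore never
affect those up to `j`. -/
theorem bump_filter (j : ℕ) (X : Finset ℕ) (x : Option ℕ) :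
    bump (X.filter (· ≤ j)) (x.filter (fun v => decide (v ≤ j))) =
      (bump X x).filter (fun v => decide (v ≤ j)) := by
  ext v
  simp only [bump_eq_some, Option.filter_eq_some_iff, Finset.mem_filter, decide_eq_true_eq]
  constructor
  · rintro ⟨z, ⟨h1, h2⟩, ⟨h3, h4⟩, h5, h6⟩
    refine ⟨⟨z, h1, h3, h5, fun e he hze => ?_⟩, h4⟩
    by_cases hej : e ≤ j
    · exact h6 e ⟨he, hej⟩ hze
    · omega
  · rintro ⟨⟨z, h1, h3, h5, h6⟩, h4⟩
    exact ⟨z, ⟨h1, by omega⟩, ⟨h3, h4⟩, h5, fun e he hze => h6 e he.1 hze⟩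

theorem rowStep_filter (j : ℕ) (X : Finset ℕ) (x : Option ℕ) :
    rowStep (X.filter (· ≤ j)) (x.filter (fun v => decide (v ≤ j))) =
      (rowStep X x).filter (· ≤ j) := by
  ext e
  simp only [mem_rowStep, bump_filter, Finset.mem_filter, ne_eq, Option.filter_eq_some_iff,
    decide_eq_true_eq]
  tauto

theorem rowState_cut (j : ℕ) (f : ℕ → Option ℕ) (i : ℕ) :
    rowState (cut j f) i = (rowState f i).filter (· ≤ j) := by
  induction i with
  | zero => rfl
  | succ i ih =>
    show rowStep _ _ = _
    rw [ih]
    exact rowStep_filter j _ _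

theorem skel_cut (j : ℕ) (f : ℕ → Option ℕ) : skel (cut j f) = cut j (skel f) := by
  funext i
  cases i with
  | zero => rfl
  | succ i =>
    show bump _ _ = _
    rw [rowState_cut]
    exact bump_filter j _ _

theorem iterate_skel_cut (j : ℕ) (f : ℕ → Option ℕ) (n : ℕ) :
    skel^[n] (cut j f) = cut j (skel^[n] f) := by
  induction n generalizing f with
  | zero => rfl
  | succ n ih => rw [Function.iterate_succ_apply, skel_cut, ih, Function.iterate_succ_apply]

theorem iterate_skel_inj {f : ℕ → Option ℕ} (hf : WordInj f) (n : ℕ) : WordInj (skel^[n] f) := by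
  induction n generalizing f with
  | zero => exact hf
  | succ n ih => exact ih (skel_inj hf)

theorem exists_of_iterate_skel {f : ℕ → Option ℕ} {n m i v : ℕ} (h : skel^[n + m] f i = some v) :
    ∃ s ≤ i, skel^[n] f s = some v := by
  induction m generalizing i with
  | zero => exact ⟨i, le_rfl, h⟩
  | succ m ih =>
    rw [← Nat.add_assoc, Function.iterate_succ_apply'] at h
    obtain ⟨s, -, h2, h3⟩ := exists_west h
    obtain ⟨s', h4, h5⟩ := ih h3
    exact ⟨s', by omega, h5⟩

/-- To reach a later row, an entry must have been bumped from each earlier one, and it does not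
return there. -/
theorem rowState_iterate_disjoint {f : ℕ → Option ℕ} (hf : WordInj f) {n m i v : ℕ}
    (hn : v ∈ rowState (skel^[n] f) i) (hm : v ∈ rowState (skel^[m] f) i) : n = m := by
  have key : ∀ {n m}, v ∈ rowState (skel^[n] f) i → v ∈ rowState (skel^[m] f) i → ¬ n < m := by
    intro n m hn hm hlt
    obtain ⟨d, rfl⟩ : ∃ d, m = n + 1 + d := ⟨m - (n + 1), by omega⟩
    obtain ⟨s, -, h2, h3⟩ := exists_of_mem_rowState hm
    obtain ⟨s', h4, h5⟩ := exists_of_iterate_skel h3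
    rw [Function.iterate_succ_apply'] at h5
    exact ((mem_rowState_iff (iterate_skel_inj hf n)).1 hn).2 s' (by omega) h5
  have := key hn hm
  have := key hm hn
  omega

/-! ### The growth diagram in terms of rows -/

/-- The number of entries at most `j` in each of the rows `X 0, X 1, …`. -/
def rowCount (X : ℕ → Finset ℕ) (j : ℕ) : Entries := fun n => ((X n).filter (· ≤ j)).card

theorem card_filter_rowStep {X : Finset ℕ} {z j : ℕ} (hz : z ∉ X) :
    ((rowStep X (some z)).filter (· ≤ j)).card = ((X.filter (· ≤ j)).card +
      if z ≤ j ∧ ∀ w, bump X (some z) = some w → j < w then 1 else 0) := by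
  cases hb : bump X (some z) with
  | none =>
    have hX : rowStep X (some z) = insert z X := by
      ext e; rw [mem_rowStep, hb]; grind
    rw [hX, Finset.filter_insert]
    by_cases hzj : z ≤ j
    · rw [if_pos hzj, Finset.card_insert_of_notMem (by simp [hz])]
      simp [hzj]
    · simp [hzj]
  | some w =>
    obtain ⟨z', hz', hw, hzw, -⟩ := bump_eq_some.1 hb
    obtain rfl : z = z' := by simpa using hz'
    have hX : rowStep X (some z) = insert z (X.erase w) := by
      ext e; rw [mem_rowStep, hb]; grind
    rw [hX, Finset.filter_insert, Finset.filter_erase]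
    by_cases hzj : z ≤ j
    · rw [if_pos hzj, Finset.card_insert_of_notMem (by simp [hz])]
      by_cases hwj : w ≤ j
      · have hm : w ∈ X.filter (· ≤ j) := by simp [hw, hwj]
        have := Finset.card_pos.2 ⟨w, hm⟩
        rw [Finset.card_erase_of_mem hm, if_neg (by simp; omega)]
        omega
      · rw [Finset.erase_eq_of_notMem (by simp [hwj]), if_pos ⟨hzj, by simp; omega⟩]
    · rw [if_neg hzj, Finset.erase_eq_of_notMem (by simp; omega), if_neg (by simp [hzj])]
      omega

/-! ### One insertion and the local rules -/

section Insertion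

variable {X : ℕ → Finset ℕ} {ζ : ℕ → Option ℕ}

/-- The sequence `ζ` consists of the numbers inserted into the rows `X 0, X 1, …` of a tableau. -/
structure IsInsertion (X : ℕ → Finset ℕ) (ζ : ℕ → Option ℕ) : Prop where
  bump_eq : ∀ n, bump (X n) (ζ n) = ζ (n + 1)
  fresh : ∀ z, ζ 0 = some z → ∀ n, z ∉ X n
  disjoint : ∀ n m v, v ∈ X n → v ∈ X m → n = m

/-- The inserted numbers in the rows above and in the row `n` are at most `j`, and the following
ones are larger. -/
def BumpsAt (ζ : ℕ → Option ℕ) (j n : ℕ) : Prop :=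
  (∃ z, ζ n = some z ∧ z ≤ j) ∧ ∀ w, ζ (n + 1) = some w → j < w

namespace IsInsertion

theorem mem_of_succ (h : IsInsertion X ζ) {n w : ℕ} (hw : ζ (n + 1) = some w) :
    ∃ z, ζ n = some z ∧ w ∈ X n ∧ z < w := by
  rw [← h.bump_eq] at hw
  obtain ⟨z, h1, h2, h3, -⟩ := bump_eq_some.1 hw
  exact ⟨z, h1, h2, h3⟩

theorem notMem (h : IsInsertion X ζ) {n v : ℕ} (hv : ζ n = some v) : v ∉ X n := by
  cases n with
  | zero => exact h.fresh v hv 0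
  | succ n =>
    intro hm
    obtain ⟨-, -, h2, -⟩ := h.mem_of_succ hv
    have := h.disjoint _ _ _ h2 hm
    omega

theorem le_of_le (h : IsInsertion X ζ) {n m v : ℕ} (hnm : n ≤ m) (hv : ζ m = some v) :
    ∃ u, ζ n = some u ∧ u ≤ v := by
  induction m, hnm using Nat.le_induction generalizing v with
  | base => exact ⟨v, hv, le_rfl⟩
  | succ m _ ih =>
    obtain ⟨z, h1, -, h3⟩ := h.mem_of_succ hv
    obtain ⟨u, h4, h5⟩ := ih h1
    exact ⟨u, h4, by omega⟩

theorem bumpsAt_unique (h : IsInsertion X ζ) {j n m : ℕ} (hn : BumpsAt ζ j n)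
    (hm : BumpsAt ζ j m) : n = m := by
  have key : ∀ {n m}, BumpsAt ζ j n → BumpsAt ζ j m → ¬ n < m := by
    rintro n m ⟨-, h1⟩ ⟨⟨z, h2, h3⟩, -⟩ hlt
    obtain ⟨u, h4, h5⟩ := h.le_of_le (n := n + 1) hlt h2
    have := h1 u h4
    omega
  have := key hn hm
  have := key hm hn
  omega

/-- The inserted numbers strictly increase from row to row, so only finitely many of them are at
most `j`. -/
theorem exists_bumpsAt (h : IsInsertion X ζ) {j z : ℕ} (hz : ζ 0 = some z) (hzj : z ≤ j) :
    ∃ n, BumpsAt ζ j n := by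
  by_contra hcon
  push Not at hcon
  have key : ∀ n, ∃ u, ζ n = some u ∧ u ≤ j ∧ n ≤ u := by
    intro n
    induction n with
    | zero => exact ⟨z, hz, hzj, Nat.zero_le _⟩
    | succ n ih =>
      obtain ⟨u, h1, h2, h3⟩ := ih
      have h4 := hcon n
      unfold BumpsAt at h4
      push Not at h4
      obtain ⟨w, h5, h6⟩ := h4 ⟨u, h1, h2⟩
      obtain ⟨u', h7, -, h8⟩ := h.mem_of_succ h5
      have : u = u' := by rw [h1] at h7; exact Option.some.inj h7
      exact ⟨w, h5, h6, by omega⟩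
  obtain ⟨u, -, h2, h3⟩ := key (j + 1)
  omega

open Classical in
theorem rowCount_rowStep (h : IsInsertion X ζ) (j n : ℕ) :
    rowCount (fun n => rowStep (X n) (ζ n)) j n =
      rowCount X j n + if BumpsAt ζ j n then 1 else 0 := by
  unfold rowCount
  cases hζ : ζ n with
  | none =>
    have : ¬ BumpsAt ζ j n := by
      rintro ⟨⟨z, h1, -⟩, -⟩
      rw [hζ] at h1; cases h1
    simp [this, hζ]
  | some z =>
    show ((rowStep (X n) (ζ n)).filter (· ≤ j)).card = _
    rw [hζ, card_filter_rowStep (h.notMem hζ), ← hζ, h.bump_eq]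
    congr 1
    refine if_congr ?_ rfl rfl
    unfold BumpsAt
    rw [hζ]
    simp

open Classical in
theorem rowCount_rowStep_of_bumpsAt (h : IsInsertion X ζ) {j n : ℕ} (hn : BumpsAt ζ j n) :
    rowCount (fun n => rowStep (X n) (ζ n)) j = rowCount X j + Pi.single n 1 := by
  funext m
  rw [h.rowCount_rowStep, Pi.add_apply, Pi.single_apply]
  congr 1
  refine if_congr ⟨fun hm => h.bumpsAt_unique hm hn, ?_⟩ rfl rfl
  rintro rfl; exact hn

open Classical in
theorem rowCount_rowStep_of_lt (h : IsInsertion X ζ) {j : ℕ} (hj : ∀ z, ζ 0 = some z → j < z) :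
    rowCount (fun n => rowStep (X n) (ζ n)) j = rowCount X j := by
  funext m
  rw [h.rowCount_rowStep, if_neg, Nat.add_zero]
  rintro ⟨⟨z, h1, h2⟩, -⟩
  obtain ⟨u, h3, h4⟩ := h.le_of_le (Nat.zero_le m) h1
  have := hj u h3
  omega

theorem rowCount_succ_of_mem (h : IsInsertion X ζ) {j m : ℕ} (hm : j + 1 ∈ X m) :
    rowCount X (j + 1) = rowCount X j + Pi.single m 1 := by
  funext n
  have hsplit : (X n).filter (· ≤ j + 1) =
      (X n).filter (· ≤ j) ∪ (X n).filter (· = j + 1) := by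
    ext e; simp only [Finset.mem_filter, Finset.mem_union]
    constructor
    · rintro ⟨h1, h2⟩
      rcases h2.lt_or_eq with h3 | h3
      · exact Or.inl ⟨h1, by omega⟩
      · exact Or.inr ⟨h1, h3⟩
    · rintro (⟨h1, h2⟩ | ⟨h1, h2⟩) <;> exact ⟨h1, by omega⟩
  have hdisj : Disjoint ((X n).filter (· ≤ j)) ((X n).filter (· = j + 1)) := by
    rw [Finset.disjoint_left]
    intro e h1 h2
    simp only [Finset.mem_filter] at h1 h2
    omega
  show ((X n).filter (· ≤ j + 1)).card = ((X n).filter (· ≤ j)).card + _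
  rw [hsplit, Finset.card_union_of_disjoint hdisj, Pi.single_apply, Finset.filter_eq']
  congr 1
  by_cases hnm : n = m
  · subst hnm
    rw [if_pos hm, if_pos rfl, Finset.card_singleton]
  · rw [if_neg (fun h' => hnm (h.disjoint _ _ _ h' hm)), if_neg hnm, Finset.card_empty]

theorem rowCount_succ_of_notMem {j : ℕ} (hj : ∀ m, j + 1 ∉ X m) :
    rowCount X (j + 1) = rowCount X j := by
  funext n
  unfold rowCount
  congr 1
  refine Finset.filter_congr fun e he => ?_
  have : e ≠ j + 1 := by rintro rfl; exact hj n he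
  omega

theorem add_single_ne (v : Entries) (m : ℕ) : v + Pi.single m 1 ≠ v := by
  intro h
  have := congrFun h m
  simp at this

/-- Going up adds a cell in the row of the entry `j + 1`, if it is present; going right adds a cell
in the row where the bumping of entries at most `j` ends, if the inserted number is at most `j`.
Rule (2) is the case where these rows coincide and `j + 1` is bumped into the next row. When neither
cell is added, rule (3) asks whether `j + 1` itself is inserted. -/
theorem localRule_eq (h : IsInsertion X ζ) (j : ℕ) :
    rowCount (fun n => rowStep (X n) (ζ n)) (j + 1) =
      localRule (rowCount X j) (rowCount X (j + 1)) (rowCount (fun n => rowStep (X n) (ζ n)) j)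
        (ζ 0 = some (j + 1)) := by
  set v := rowCount X j with hv
  by_cases hmem : ∃ m, j + 1 ∈ X m
  · obtain ⟨m, hm⟩ := hmem
    have hNW := h.rowCount_succ_of_mem hm
    have hz0 : ζ 0 ≠ some (j + 1) := fun h0 => h.fresh _ h0 m hm
    by_cases hlt : ∀ z, ζ 0 = some z → j < z
    · rw [h.rowCount_rowStep_of_lt hlt, h.rowCount_rowStep_of_lt (j := j + 1), hNW, ← hv,
        localRule, if_pos (add_single_ne v m)]
      · funext i; simp
      · intro z hz
        have := hlt z hz
        have : z ≠ j + 1 := by rintro rfl; exact hz0 hz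
        omega
    · push Not at hlt
      obtain ⟨z, hz, hzj⟩ := hlt
      obtain ⟨n, hn⟩ := h.exists_bumpsAt hz hzj
      rw [h.rowCount_rowStep_of_bumpsAt hn]
      by_cases hnm : n = m
      · subst hnm
        obtain ⟨⟨u, hu, huj⟩, hw⟩ := hn
        -- Every entry of row `n` larger than `u` exceeds `j`, so `j + 1` is the least of them and
        -- is bumped.
        have hn1 : ζ (n + 1) = some (j + 1) := by
          rw [← h.bump_eq, hu, bump_eq_some]
          refine ⟨u, rfl, hm, by omega, fun e he hue => ?_⟩
          cases hb : ζ (n + 1) with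
          | none =>
            rw [← h.bump_eq, hu, bump_some_eq_none] at hb
            have := hb e he
            omega
          | some w =>
            have h1 := hw w hb
            rw [← h.bump_eq, hu, bump_eq_some] at hb
            obtain ⟨u', h2, -, -, h3⟩ := hb
            obtain rfl : u = u' := by simpa using h2
            have := h3 e he hue
            omega
        have hn2 : BumpsAt ζ (j + 1) (n + 1) := by
          refine ⟨⟨_, hn1, le_rfl⟩, fun w hw => ?_⟩
          obtain ⟨z', h1, -, h3⟩ := h.mem_of_succ hw
          rw [hn1] at h1
          have := Option.some.inj h1
          omega
        rw [h.rowCount_rowStep_of_bumpsAt hn2, hNW, ← hv, localRule, if_neg (by simp),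
          if_pos (add_single_ne v n).symm]
        have hset : {i | v i ≠ (v + Pi.single n 1 : Entries) i} = {n} := by
          ext i
          simp only [Set.mem_ofPred_eq, Pi.add_apply, Pi.single_apply, Set.mem_singleton_iff]
          split_ifs with hi <;> simp [hi]
        rw [hset, csInf_singleton]
      -- Here `j + 1` stays in row `m`, and the two added cells lie in different rows, so rule (1)
      -- collects both.
      · have hn2 : BumpsAt ζ (j + 1) n := by
          obtain ⟨⟨u, hu, huj⟩, hw⟩ := hn
          refine ⟨⟨u, hu, by omega⟩, fun w hw' => ?_⟩
          have h1 := hw w hw'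
          obtain ⟨-, -, h2, -⟩ := h.mem_of_succ hw'
          have : w ≠ j + 1 := by rintro rfl; exact hnm (h.disjoint _ _ _ h2 hm)
          omega
        rw [h.rowCount_rowStep_of_bumpsAt hn2, hNW, ← hv, localRule, if_pos]
        · funext i
          simp only [Pi.add_apply, Pi.single_apply]
          split_ifs with h1 h2 <;> omega
        · intro hcon
          have := congrFun hcon m
          simp [Ne.symm hnm] at this
  · push Not at hmem
    have hNW := rowCount_succ_of_notMem hmem
    have hsucc : ∀ {n}, BumpsAt ζ j n → BumpsAt ζ (j + 1) n := by
      rintro n ⟨⟨u, hu, huj⟩, hw⟩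
      refine ⟨⟨u, hu, by omega⟩, fun w hw' => ?_⟩
      have h1 := hw w hw'
      obtain ⟨-, -, h2, -⟩ := h.mem_of_succ hw'
      have : w ≠ j + 1 := by rintro rfl; exact hmem n h2
      omega
    by_cases hlt : ∀ z, ζ 0 = some z → j < z
    · rw [h.rowCount_rowStep_of_lt hlt, hNW, ← hv, localRule, if_neg (by simp), if_neg (by simp)]
      by_cases hz0 : ζ 0 = some (j + 1)
      · rw [if_pos hz0, h.rowCount_rowStep_of_bumpsAt (n := 0), hNW]
        refine ⟨⟨_, hz0, le_rfl⟩, fun w hw => ?_⟩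
        obtain ⟨z', h1, -, h3⟩ := h.mem_of_succ hw
        rw [hz0] at h1
        have := Option.some.inj h1
        omega
      · rw [if_neg hz0, h.rowCount_rowStep_of_lt, hNW]
        intro z hz
        have := hlt z hz
        have : z ≠ j + 1 := by rintro rfl; exact hz0 hz
        omega
    · push Not at hlt
      obtain ⟨z, hz, hzj⟩ := hlt
      obtain ⟨n, hn⟩ := h.exists_bumpsAt hz hzj
      rw [h.rowCount_rowStep_of_bumpsAt hn, h.rowCount_rowStep_of_bumpsAt (hsucc hn), hNW, ← hv,
        localRule, if_pos (add_single_ne v n).symm]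
      funext i
      simp

end IsInsertion

end Insertion

/-- The numbers inserted into the rows of the tableau at the time `i + 1`. -/
theorem isInsertion_skel {f : ℕ → Option ℕ} (hf : WordInj f) (i : ℕ) :
    IsInsertion (fun n => rowState (skel^[n] f) i) (fun n => skel^[n] f (i + 1)) where
  bump_eq := by
    intro n
    simp only [Function.iterate_succ_apply']
    rfl
  fresh := by
    intro z hz n hm
    obtain ⟨s, -, h2, h3⟩ := exists_of_mem_rowState hm
    obtain ⟨s', h4, h5⟩ := exists_of_iterate_skel (n := 0) (m := n) (by rw [Nat.zero_add]; exact h3)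
    have := hf _ _ _ hz h5
    omega
  disjoint := fun n m v hn hm => rowState_iterate_disjoint hf hn hm

/-- The counts vanish on the left edge and, values being positive, on the bottom edge; by
`localRule_eq` they obey the recursion of the growth diagram. -/
theorem growth_eq_rowCount {f : ℕ → Option ℕ} (hf : WordInj f) (hpos : ∀ s v, f s = some v → 1 ≤ v)
    {P : Finset Square} (hP : ∀ i j, (i + 1, j + 1) ∈ P ↔ f (i + 1) = some (j + 1)) (i j : ℕ) :
    growth P i j = rowCount (fun n => rowState (skel^[n] f) i) j := by
  induction i generalizing j with
  | zero =>
    rw [growth]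
    funext n
    simp [rowCount, rowState]
  | succ i ihi =>
    induction j with
    | zero =>
      rw [growth]
      funext n
      simp only [rowCount, Pi.zero_apply]
      symm
      rw [Finset.card_eq_zero, Finset.filter_eq_empty_iff]
      intro e he
      obtain ⟨s, -, h2, h3⟩ := exists_of_mem_rowState he
      obtain ⟨s', h4, h5⟩ :=
        exists_of_iterate_skel (n := 0) (m := n) (by rw [Nat.zero_add]; exact h3)
      have := hpos _ _ h5
      omega
    | succ j ihj =>
      rw [growth, ihi, ihi, ihj]
      have := (isInsertion_skel hf i).localRule_eq j
      simp only [hP]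
      exact this.symm

/-! ### Tableaux in terms of rows -/

/-- The tableau `T` has the increasing rows with entries `X 0, X 1, …`, up to the first empty
one, and the others are empty. -/
def HasRows : Tableau → (ℕ → Finset ℕ) → Prop
  | [], X => ∀ n, X n = ∅
  | r :: rs, X => r ≠ [] ∧ r.SortedLT ∧ r.toFinset = X 0 ∧ HasRows rs (fun n => X (n + 1))

theorem HasRows.unique {T T' : Tableau} {X : ℕ → Finset ℕ} (h : HasRows T X)
    (h' : HasRows T' X) : T = T' := by
  induction T generalizing T' X with
  | nil =>
    cases T' with
    | nil => rfl
    | cons r rs => exact absurd (List.toFinset_eq_empty_iff r |>.1 (h'.2.2.1.trans (h 0))) h'.1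
  | cons r rs ih =>
    cases T' with
    | nil => exact absurd (List.toFinset_eq_empty_iff r |>.1 (h.2.2.1.trans (h' 0))) h.1
    | cons r' rs' =>
      rw [ih h.2.2.2 h'.2.2.2]
      congr 1
      refine h.2.1.eq_of_mem_iff h'.2.1 fun a => ?_
      rw [← List.mem_toFinset, ← List.mem_toFinset, h.2.2.1, h'.2.2.1]

theorem rowInsert_ne_nil (x : ℕ) (l : List ℕ) : (rowInsert x l).1 ≠ [] := by
  cases l with
  | nil => simp [rowInsert]
  | cons y ys => rw [rowInsert]; split_ifs <;> simp

theorem rowInsert_spec {x : ℕ} {l : List ℕ} (hl : l.Pairwise (· < ·)) (hx : x ∉ l) :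
    (rowInsert x l).2 = bump l.toFinset (some x) ∧
      (rowInsert x l).1.toFinset = rowStep l.toFinset (some x) ∧
      (rowInsert x l).1.Pairwise (· < ·) := by
  induction l with
  | nil =>
    refine ⟨?_, ?_, by simp [rowInsert]⟩
    · symm; rw [rowInsert, bump_some_eq_none]; simp
    · ext e; rw [mem_rowStep]; simp [rowInsert, eq_comm]
  | cons y ys ih =>
    rw [List.pairwise_cons] at hl
    have hxy : x ≠ y := by rintro rfl; simp at hx
    have hxs : x ∉ ys := fun h => hx (List.mem_cons_of_mem _ h)
    rw [rowInsert]
    split_ifs with hlt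
    · have hb : bump (y :: ys).toFinset (some x) = some y := by
        rw [bump_eq_some]
        refine ⟨x, rfl, by simp, hlt, fun e he _ => ?_⟩
        rw [List.mem_toFinset, List.mem_cons] at he
        rcases he with rfl | he
        · exact le_rfl
        · exact (hl.1 e he).le
      refine ⟨hb.symm, ?_, ?_⟩
      · ext e
        rw [mem_rowStep, hb]
        have hyy : y ∉ ys := fun h => (hl.1 y h).false
        simp only [List.mem_toFinset, List.mem_cons]
        grind
      · rw [List.pairwise_cons]
        exact ⟨fun e he => hlt.trans (hl.1 e he), hl.2⟩
    · obtain ⟨h1, h2, h3⟩ := ih hl.2 hxs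
      have hyx : y < x := by omega
      have hb : bump ys.toFinset (some x) = bump (y :: ys).toFinset (some x) := by
        apply bump_congr
        intro v
        simp only [bump_eq_some, List.mem_toFinset, List.mem_cons, Option.some.injEq,
          exists_eq_left']
        constructor
        · rintro ⟨g1, g2, g3⟩
          refine ⟨Or.inr g1, g2, ?_⟩
          rintro e (rfl | he) hxe
          · omega
          · exact g3 e he hxe
        · rintro ⟨rfl | g1, g2, g3⟩
          · omega
          · exact ⟨g1, g2, fun e he => g3 e (Or.inr he)⟩
      have hmem : ∀ e, e ∈ (rowInsert x ys).1 ↔ e ∈ rowStep ys.toFinset (some x) := by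
        intro e; rw [← h2, List.mem_toFinset]
      refine ⟨by rw [← hb]; exact h1, ?_, ?_⟩
      · ext e
        rw [List.mem_toFinset, List.mem_cons, hmem, mem_rowStep, mem_rowStep, ← hb]
        have : bump ys.toFinset (some x) ≠ some y := by
          intro h
          obtain ⟨z, hz, -, h4, -⟩ := bump_eq_some.1 h
          have := Option.some.inj hz
          omega
        simp only [List.mem_toFinset, List.mem_cons]
        grind
      · rw [List.pairwise_cons]
        refine ⟨fun e he => ?_, h3⟩
        rcases mem_rowStep.1 ((hmem e).1 he) with h | ⟨h, -⟩
        · have := Option.some.inj h; omega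
        · exact hl.1 e (List.mem_toFinset.1 h)

/-- Translates list insertion into the set model. The second part reads off the row of the new cell
as the last one into which something is inserted. -/
theorem tableauInsert_spec {T : Tableau} {X : ℕ → Finset ℕ} {ζ : ℕ → Option ℕ} {z : ℕ}
    (hT : HasRows T X) (hz : ζ 0 = some z) (hζ : ∀ n, bump (X n) (ζ n) = ζ (n + 1))
    (hX : ∀ n v, ζ n = some v → v ∉ X n) :
    HasRows (tableauInsert z T).1 (fun n => rowStep (X n) (ζ n)) ∧
      ∀ n, (ζ n).isSome ↔ n ≤ (tableauInsert z T).2 := by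
  have hnone : ∀ m, ζ m = none → ∀ n, ζ (m + n) = none := by
    intro m hm n
    induction n with
    | zero => exact hm
    | succ n ih => rw [← Nat.add_assoc, ← hζ, ih]; rfl
  induction T generalizing X ζ z with
  | nil =>
    have h1 : ζ 1 = none := by
      rw [← hζ, hz, bump_some_eq_none]
      simp [hT 0]
    constructor
    · refine ⟨by simp, List.sortedLT_iff_pairwise.2 (List.pairwise_singleton _ _), ?_, fun n => ?_⟩
      · ext e; simp only [mem_rowStep, hz, hT 0]; simp [eq_comm]
      · show rowStep (X (n + 1)) (ζ (n + 1)) = ∅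
        rw [hT, Nat.add_comm, hnone 1 h1, rowStep_none]
    · intro n
      cases n with
      | zero => simp [hz]
      | succ n => rw [Nat.add_comm, hnone 1 h1]; simp [tableauInsert]
  | cons r rs ih =>
    obtain ⟨hr, hs, hX0, hrs⟩ := hT
    have hzr : z ∉ r := by
      rw [← List.mem_toFinset, hX0]; exact hX 0 z hz
    obtain ⟨g1, g2, g3⟩ := rowInsert_spec (List.sortedLT_iff_pairwise.1 hs) hzr
    have g4 := rowInsert_ne_nil z r
    have hζ1 := hζ 0
    rw [hz, ← hX0, ← g1] at hζ1
    have hstep : rowStep (X 0) (ζ 0) = rowStep r.toFinset (some z) := by rw [hz, hX0]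
    rcases hri : rowInsert z r with ⟨r', o⟩
    rw [hri] at g2 g3 g4 hζ1
    cases o with
    | none =>
      have hti : tableauInsert z (r :: rs) = (r' :: rs, 0) := by rw [tableauInsert, hri]
      have h1 : ζ 1 = none := hζ1.symm
      rw [hti]
      constructor
      · refine ⟨g4, List.sortedLT_iff_pairwise.2 g3, g2.trans hstep.symm, ?_⟩
        have : (fun n => rowStep (X (n + 1)) (ζ (n + 1))) = fun n => X (n + 1) := by
          funext n
          rw [Nat.add_comm n 1, hnone 1 h1, rowStep_none]
        rw [this]
        exact hrs
      · intro n
        cases n with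
        | zero => simp [hz]
        | succ n => rw [Nat.add_comm, hnone 1 h1]; simp
    | some y =>
      have hti : tableauInsert z (r :: rs) =
          (r' :: (tableauInsert y rs).1, (tableauInsert y rs).2 + 1) := by
        rw [tableauInsert, hri]
      obtain ⟨i1, i2⟩ := ih (ζ := fun n => ζ (n + 1)) hrs hζ1.symm (fun n => hζ (n + 1))
        (fun n => hX (n + 1)) (fun m hm n => by
          have := hnone (m + 1) hm n
          rw [Nat.add_right_comm] at this; exact this)
      rw [hti]
      refine ⟨⟨g4, List.sortedLT_iff_pairwise.2 g3, g2.trans hstep.symm, i1⟩, fun n => ?_⟩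
      cases n with
      | zero => simp [hz]
      | succ n => rw [i2 n]; simp

/-- The pair of tableaux obtained from the letters `f 1, …, f i` of a word. -/
def rsRun (f : ℕ → Option ℕ) : ℕ → Tableau × Tableau
  | 0 => ([], [])
  | i + 1 =>
    match f (i + 1) with
    | none => rsRun f i
    | some z => rsStep (rsRun f i) (i + 1, z)

theorem rsRun_succ_none {f : ℕ → Option ℕ} {i : ℕ} (h : f (i + 1) = none) :
    rsRun f (i + 1) = rsRun f i := by rw [rsRun, h]

theorem rsRun_succ_some {f : ℕ → Option ℕ} {i z : ℕ} (h : f (i + 1) = some z) :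
    rsRun f (i + 1) = rsStep (rsRun f i) (i + 1, z) := by rw [rsRun, h]

theorem iterate_skel_none_of_none {f : ℕ → Option ℕ} {i : ℕ} (h : f i = none) (n : ℕ) :
    skel^[n] f i = none := by
  induction n generalizing f with
  | zero => exact h
  | succ n ih =>
    refine ih ?_
    cases i with
    | zero => rfl
    | succ i => rw [skel, h]; rfl

theorem rsRun_spec {f : ℕ → Option ℕ} (hf : WordInj f) (i : ℕ) :
    HasRows (rsRun f i).1 (fun n => rowState (skel^[n] f) i) ∧
      ∀ z, f (i + 1) = some z → ∀ n, (skel^[n] f (i + 1)).isSome ↔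
        n ≤ (tableauInsert z (rsRun f i).1).2 := by
  have key : ∀ i, HasRows (rsRun f i).1 (fun n => rowState (skel^[n] f) i) →
      ∀ z, f (i + 1) = some z →
        HasRows (tableauInsert z (rsRun f i).1).1 (fun n => rowState (skel^[n] f) (i + 1)) ∧
        ∀ n, (skel^[n] f (i + 1)).isSome ↔ n ≤ (tableauInsert z (rsRun f i).1).2 := by
    intro i hi z hz
    have hI := isInsertion_skel hf i
    exact tableauInsert_spec hi hz hI.bump_eq fun n v hv => hI.notMem hv
  have hrows : HasRows (rsRun f i).1 (fun n => rowState (skel^[n] f) i) := by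
    induction i with
    | zero => exact fun n => rfl
    | succ i ih =>
      cases hfi : f (i + 1) with
      | none =>
        rw [rsRun_succ_none hfi]
        have : (fun n => rowState (skel^[n] f) (i + 1)) = fun n => rowState (skel^[n] f) i := by
          funext n
          rw [rowState, iterate_skel_none_of_none hfi, rowStep_none]
        rw [this]
        exact ih
      | some z =>
        rw [rsRun_succ_some hfi]
        exact (key i ih z hfi).1
  exact ⟨hrows, fun z hz => (key i hrows z hz).2⟩

theorem rsRun_fst_congr {f f' : ℕ → Option ℕ} (hf : WordInj f) (hf' : WordInj f') {i : ℕ}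
    (h : ∀ n, rowState (skel^[n] f) i = rowState (skel^[n] f') i) :
    (rsRun f i).1 = (rsRun f' i).1 := by
  refine (rsRun_spec hf i).1.unique ?_
  simp only [h]
  exact (rsRun_spec hf' i).1

/-- The recording tableau sees only the time and the row of each new cell, and that row is
determined by which iterated skeletons have a letter in the column. -/
theorem rsRun_snd_congr {f f' : ℕ → Option ℕ} (hf : WordInj f) (hf' : WordInj f') {i : ℕ}
    (h : ∀ n, ∀ s ≤ i, (skel^[n] f s).isSome = (skel^[n] f' s).isSome) :
    (rsRun f i).2 = (rsRun f' i).2 := by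
  induction i with
  | zero => rfl
  | succ i ih =>
    have ih := ih fun n s hs => h n s (by omega)
    have h0 := h 0 (i + 1) le_rfl
    simp only [Function.iterate_zero, id_eq] at h0
    cases hfi : f (i + 1) with
    | none =>
      rw [hfi] at h0
      have hfi' : f' (i + 1) = none := by simpa using h0.symm
      rw [rsRun_succ_none hfi, rsRun_succ_none hfi', ih]
    | some z =>
      rw [hfi] at h0
      obtain ⟨z', hfi'⟩ := Option.isSome_iff_exists.1 h0.symm
      rw [rsRun_succ_some hfi, rsRun_succ_some hfi']
      have e1 := (rsRun_spec hf i).2 z hfi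
      have e2 := (rsRun_spec hf' i).2 z' hfi'
      have hidx : (tableauInsert z (rsRun f i).1).2 = (tableauInsert z' (rsRun f' i).1).2 := by
        apply le_antisymm
        · rw [← e2, ← h _ _ le_rfl, e1]
        · rw [← e1, h _ _ le_rfl, e2]
      show appendToRow _ _ _ = appendToRow _ _ _
      rw [ih, hidx]

/-- The letters `f 1, …, f N` of a word with their positions. -/
def wordSquares (f : ℕ → Option ℕ) (N : ℕ) : List Square :=
  (List.range N).filterMap fun i => (f (i + 1)).map fun v => (i + 1, v)

theorem foldl_wordSquares (f : ℕ → Option ℕ) (N : ℕ) :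
    (wordSquares f N).foldl rsStep ([], []) = rsRun f N := by
  induction N with
  | zero => rfl
  | succ N ih =>
    rw [wordSquares, List.range_succ, List.filterMap_append, List.foldl_append]
    change List.foldl rsStep (List.foldl rsStep _ (wordSquares f N)) _ = _
    rw [ih]
    cases hf : f (N + 1) with
    | none => rw [rsRun_succ_none hf]; simp [hf]
    | some z => rw [rsRun_succ_some hf]; simp [hf]

theorem twoLine_eq {Q : Finset Square} {f : ℕ → Option ℕ} {N : ℕ}
    (hQ : ∀ i j, (i, j) ∈ Q ↔ 1 ≤ i ∧ i ≤ N ∧ f i = some j) : twoLine Q = wordSquares f N := by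
  have hmem : ∀ x : Square, x ∈ wordSquares f N ↔ x ∈ Q := by
    rintro ⟨i, j⟩
    rw [hQ, wordSquares, List.mem_filterMap]
    simp only [List.mem_range, Option.map_eq_some_iff, Prod.mk.injEq]
    constructor
    · rintro ⟨s, hs, v, hv, rfl, rfl⟩
      exact ⟨by omega, by omega, hv⟩
    · rintro ⟨h1, h2, h3⟩
      obtain ⟨s, rfl⟩ : ∃ s, i = s + 1 := ⟨i - 1, by omega⟩
      exact ⟨s, by omega, j, h3, rfl, rfl⟩
  have hsort : ((wordSquares f N).map toLex).SortedLT := by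
    rw [List.sortedLT_iff_pairwise, List.pairwise_map, wordSquares, List.pairwise_filterMap]
    refine List.pairwise_lt_range.imp ?_
    rintro i i' hlt x hx y hy
    rw [Option.map_eq_some_iff] at hx hy
    obtain ⟨v, -, rfl⟩ := hx
    obtain ⟨w, -, rfl⟩ := hy
    rw [Prod.Lex.toLex_lt_toLex]
    left
    simp only
    omega
  have : (Q.map toLex.toEmbedding).sort (· ≤ ·) = (wordSquares f N).map toLex := by
    refine (Finset.sortedLT_sort _).eq_of_mem_iff hsort fun a => ?_
    rw [Finset.mem_sort, Finset.mem_map, List.mem_map]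
    simp only [hmem]
    rfl
  rw [twoLine, this, List.map_map]
  exact List.map_id _

theorem ins_eq {Q : Finset Square} {f : ℕ → Option ℕ} {N : ℕ}
    (hQ : ∀ i j, (i, j) ∈ Q ↔ 1 ≤ i ∧ i ≤ N ∧ f i = some j) : ins Q = (rsRun f N).1 := by
  rw [ins, twoLine_eq hQ, foldl_wordSquares]

theorem recT_eq {Q : Finset Square} {f : ℕ → Option ℕ} {N : ℕ}
    (hQ : ∀ i j, (i, j) ∈ Q ↔ 1 ≤ i ∧ i ≤ N ∧ f i = some j) : recT Q = (rsRun f N).2 := by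
  rw [recT, twoLine_eq hQ, foldl_wordSquares]

/-! ### The smallest occurrence -/

theorem IsDecreasing.lt {f : ℕ → Option ℕ} {p : ℕ} {q : ℕ → ℕ × ℕ} (h : IsDecreasing f p q)
    {i j : ℕ} (hij : i < j) (hj : j ≤ p) : (q i).1 < (q j).1 ∧ (q j).2 < (q i).2 := by
  induction j, hij using Nat.le_induction with
  | base => exact h.2 i hj
  | succ j hij ih =>
    have h1 := ih (by omega)
    have h2 := h.2 j hj
    exact ⟨by omega, by omega⟩

section Minimal

variable {f : ℕ → Option ℕ} {K : ℕ} {c r : ℕ → ℕ}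

/-- Replace a segment of a decreasing sequence by another one. -/
theorem exists_splice (hlt : ∀ t, 1 ≤ t → t ≤ K → c t < c (t + 1) ∧ r (t + 1) < r t)
    (hmem : ∀ t, 1 ≤ t → t ≤ K + 1 → f (c t) = some (r t)) {t n u L : ℕ} {y : ℕ → ℕ × ℕ}
    (hy : IsDecreasing f n y) (ht : t ≤ K + 1) (h1 : c t < (y 0).1) (h2 : (y 0).2 < r t)
    (hu1 : 1 ≤ u) (hu : u ≤ K + 1 → (y n).1 < c u ∧ r u < (y n).2)
    (hL : L + u = t + n + K + 2) :
    ∃ W, IsDecreasing f L W ∧ (∀ j < t, (W j).2 = r (j + 1)) ∧ W t = y 0 := by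
  refine ⟨fun j => if j < t then (c (j + 1), r (j + 1)) else if j ≤ t + n then y (j - t)
    else (c (j + u - (t + n + 1)), r (j + u - (t + n + 1))), ⟨?_, ?_⟩, ?_, ?_⟩
  · intro j hj
    dsimp only
    split_ifs with g1 g2
    · exact hmem _ (by omega) (by omega)
    · exact hy.1 _ (by omega)
    · exact hmem _ (by omega) (by omega)
  · intro j hj
    dsimp only
    rcases Nat.lt_or_ge j t with g1 | g1
    · rcases Nat.lt_or_ge (j + 1) t with g2 | g2
      · rw [if_pos g1, if_pos g2]
        exact hlt (j + 1) (by omega) (by omega)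
      · obtain rfl : t = j + 1 := by omega
        rw [if_pos g1, if_neg (by omega), if_pos (by omega), Nat.sub_self]
        exact ⟨h1, h2⟩
    · rw [if_neg (show ¬ j < t by omega), if_neg (show ¬ j + 1 < t by omega)]
      rcases Nat.lt_or_ge j (t + n) with g2 | g2
      · rw [if_pos g2.le, if_pos (show j + 1 ≤ t + n by omega), show j + 1 - t = j - t + 1 by omega]
        exact hy.2 _ (by omega)
      · rw [if_neg (show ¬ j + 1 ≤ t + n by omega)]
        rcases g2.eq_or_lt with g3 | g3
        · rw [if_pos (by omega), show j - t = n by omega,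
            show j + 1 + u - (t + n + 1) = u by omega]
          exact hu (by omega)
        · rw [if_neg (by omega),
            show j + 1 + u - (t + n + 1) = j + u - (t + n + 1) + 1 by omega]
          exact hlt _ (by omega) (by omega)
  · intro j hj
    simp [hj]
  · simp

/-- An exchange argument: a forbidden segment, or a part of it, can be spliced into the sequence so
as to lengthen it or to make it lexicographically smaller. -/
theorem isMinimalDescent_of_min (hinj : WordInj f)
    (hpos : ∀ s v, f s = some v → 1 ≤ s ∧ 1 ≤ v ∧ v ≤ r 1)
    (hc0 : c 0 = 0) (hr0 : r 0 = r 1 + 1) (hrK : r (K + 2) = 0)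
    (hlt : ∀ t, 1 ≤ t → t ≤ K → c t < c (t + 1) ∧ r (t + 1) < r t)
    (hmem : ∀ t, 1 ≤ t → t ≤ K + 1 → f (c t) = some (r t))
    (hmin : ∀ T, IsDecreasing f K T → ∀ q ≤ K, (∀ j < q, (T j).2 = r (j + 1)) →
      ¬ (T q).2 < r (q + 1)) :
    IsMinimalDescent f (K + 1) c r := by
  have hcol : ∀ t < K + 1, c t < c (t + 1) := by
    intro t ht
    rcases Nat.eq_zero_or_pos t with rfl | h0
    · have := hpos _ _ (hmem 1 le_rfl (by omega))
      rw [hc0]; exact this.1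
    · exact (hlt t h0 (by omega)).1
  have hrow : ∀ t ≤ K + 1, r (t + 1) < r t := by
    intro t ht
    rcases Nat.eq_zero_or_pos t with rfl | h0
    · rw [hr0]; simp
    · rcases ht.eq_or_lt with rfl | ht
      · have := hpos _ _ (hmem (K + 1) (by omega) le_rfl)
        show r (K + 2) < _
        omega
      · exact (hlt t h0 (by omega)).2
  refine ⟨hinj, hpos, hc0, hr0, hrK, hcol, hrow, hmem, ?_⟩
  -- no sequence can be longer
  have hlonger : ∀ {t n y}, IsDecreasing f n y → t ≤ K + 1 → c t < (y 0).1 → (y 0).2 < r t →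
      (y n).1 < c (t + n + 1) → ¬ r (t + n + 1) < (y n).2 := by
    intro t n y hy ht h1 h2 h3 h4
    obtain ⟨W, hW, -, -⟩ := exists_splice hlt hmem hy ht h1 h2 (u := t + n + 1) (L := K + 1)
      (by omega) (fun _ => ⟨h3, h4⟩) (by omega)
    -- Drop the first letter of the longer sequence: what remains has the right length and starts
    -- below `r 1`, the largest value.
    refine hmin (fun j => W (j + 1)) ⟨fun j hj => hW.1 _ (by omega), fun j hj => hW.2 _ (by omega)⟩
      0 (Nat.zero_le _) (by simp) ?_
    have g1 := (hW.2 0 (by omega)).2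
    have g2 := (hpos _ _ (hW.1 0 (by omega))).2.2
    simp only [Nat.zero_add] at g1 ⊢
    omega
  -- no sequence of the same length can be smaller
  have hsmaller : ∀ {t n y}, IsDecreasing f n y → t ≤ K → c t < (y 0).1 → (y 0).2 < r t →
      (t + n + 2 ≤ K + 1 → (y n).1 < c (t + n + 2) ∧ r (t + n + 2) < (y n).2) →
      ¬ (y 0).2 < r (t + 1) := by
    intro t n y hy ht h1 h2 h3 h4
    obtain ⟨W, hW, g1, g2⟩ := exists_splice hlt hmem hy (by omega) h1 h2 (u := t + n + 2) (L := K)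
      (by omega) h3 (by omega)
    refine hmin W hW t ht g1 ?_
    rw [g2]; exact h4
  intro t p htp y hy h1 h2 h3 h4
  have h5 : t + p + 2 ≤ K + 1 → (y p).1 < c (t + p + 2) ∧ r (t + p + 2) < (y p).2 := by
    intro hle
    have : c (t + p + 1) < c (t + p + 2) := hcol (t + p + 1) (by omega)
    exact ⟨by omega, h4⟩
  have h6 := hsmaller hy (by omega) h1 h2 h5
  have h7 : (y p).2 < r (t + p + 1) := by
    refine lt_of_le_of_ne (not_lt.1 (hlonger hy (by omega) h1 h2 h3)) fun heq => ?_
    have g1 := hy.1 p le_rfl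
    rw [heq] at g1
    have := hinj _ _ _ g1 (hmem (t + p + 1) (by omega) htp)
    omega
  -- Take the first place where `y` falls below the distinguished sequence; it is not the place `0`.
  -- If the letter of `y` there is right of the preceding distinguished letter, the tail of `y`
  -- gives a smaller sequence; otherwise the part of `y` before it fits in as an extra letter.
  have hex : ∃ q, q ≤ p ∧ (y q).2 < r (t + q + 1) := ⟨p, le_rfl, h7⟩
  classical
  obtain ⟨q, ⟨hqp, hq⟩, hqmin⟩ : ∃ q, (q ≤ p ∧ (y q).2 < r (t + q + 1)) ∧
      ∀ q' < q, ¬ (q' ≤ p ∧ (y q').2 < r (t + q' + 1)) :=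
    ⟨Nat.find hex, Nat.find_spec hex, fun q' h => Nat.find_min hex h⟩
  obtain ⟨q, rfl⟩ : ∃ q', q = q' + 1 := by
    refine ⟨q - 1, ?_⟩
    rcases Nat.eq_zero_or_pos q with rfl | h0
    · exact absurd hq h6
    · omega
  have hq0 : r (t + q + 1) ≤ (y q).2 := not_lt.1 fun h => hqmin q (by omega) ⟨by omega, h⟩
  have hr1 : r (t + q + 2) < r (t + q + 1) := hrow (t + q + 1) (by omega)
  have hq' : (y (q + 1)).2 < r (t + q + 2) := hq
  rcases Nat.lt_or_ge (c (t + q + 1)) (y (q + 1)).1 with hc | hc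
  · refine hsmaller (t := t + q + 1) (n := p - (q + 1)) (y := fun j => y (q + 1 + j))
      ⟨fun j hj => hy.1 _ (by omega), fun j hj => hy.2 _ (by omega)⟩ (by omega) hc
      (by simp; omega) ?_ hq'
    intro hle
    rw [show t + q + 1 + (p - (q + 1)) + 2 = t + p + 2 by omega] at hle ⊢
    simp only [show q + 1 + (p - (q + 1)) = p by omega]
    exact h5 hle
  · have hd := hy.2 q (by omega)
    have hne : r (t + q + 1) ≠ (y q).2 := by
      intro heq
      have g1 := hy.1 q (by omega)
      rw [← heq] at g1
      have := hinj _ _ _ g1 (hmem (t + q + 1) (by omega) (by omega))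
      omega
    exact hlonger (t := t) (n := q) (y := y)
      ⟨fun j hj => hy.1 _ (by omega), fun j hj => hy.2 _ (by omega)⟩ (by omega) h1 h2
      (by omega) (by omega)

end Minimal

/-! ### Words of placements -/

open Classical in
/-- The row of the marker in each column of a placement. -/
noncomputable def word (Q : Finset Square) (i : ℕ) : Option ℕ :=
  if h : ∃ j, (i, j) ∈ Q then some h.choose else none

theorem word_eq_some {Q : Finset Square} (hQ : ∀ x ∈ Q, ∀ y ∈ Q, x.1 = y.1 → x = y) {i j : ℕ} :
    word Q i = some j ↔ (i, j) ∈ Q := by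
  unfold word
  split_ifs with h
  · rw [Option.some.injEq]
    constructor
    · rintro rfl; exact h.choose_spec
    · intro hj
      exact congrArg Prod.snd (hQ _ h.choose_spec _ hj rfl)
  · simp only [false_iff]
    exact fun hj => h ⟨j, hj⟩

theorem mem_rect {i j : ℕ} {x : Square} :
    x ∈ rect i j ↔ (1 ≤ x.1 ∧ x.1 ≤ i) ∧ 1 ≤ x.2 ∧ x.2 ≤ j := by
  simp [rect, Finset.mem_product]

theorem growth_congr {P Q : Finset Square} {a b : ℕ}
    (h : ∀ x : Square, x.1 ≤ a → x.2 ≤ b → (x ∈ P ↔ x ∈ Q)) :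
    ∀ i ≤ a, ∀ j ≤ b, growth P i j = growth Q i j := by
  intro i
  induction i with
  | zero => intro _ j _; rw [growth, growth]
  | succ i ihi =>
    intro hi j
    induction j with
    | zero => intro _; rw [growth, growth]
    | succ j ihj =>
      intro hj
      rw [growth, growth, ihi (by omega) j (by omega), ihi (by omega) (j + 1) hj, ihj (by omega)]
      simp only [h (i + 1, j + 1) hi hj]

theorem card_rowStep {X : Finset ℕ} {x : Option ℕ} (hx : ∀ z, x = some z → z ∉ X) :
    (rowStep X x).card + (if (bump X x).isSome then 1 else 0) =
      X.card + if x.isSome then 1 else 0 := by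
  cases x with
  | none => simp
  | some z =>
    have hz := hx z rfl
    cases hb : bump X (some z) with
    | none =>
      have hX : rowStep X (some z) = insert z X := by
        ext e; rw [mem_rowStep, hb]; grind
      rw [hX, Finset.card_insert_of_notMem hz]
      simp
    | some w =>
      obtain ⟨z', hz', hw, hzw, -⟩ := bump_eq_some.1 hb
      have hX : rowStep X (some z) = insert z (X.erase w) := by
        ext e; rw [mem_rowStep, hb]; grind
      have := Finset.card_pos.2 ⟨w, hw⟩
      rw [hX, Finset.card_insert_of_notMem (by simp [hz]), Finset.card_erase_of_mem hw]
      simp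
      omega

/-- A row grows by one exactly when something enters it and nothing is bumped, so occupied columns
alone determine the row lengths. -/
theorem card_rowState_congr {f f' : ℕ → Option ℕ} (hf : WordInj f) (hf' : WordInj f') {i : ℕ}
    (h : ∀ n, ∀ s ≤ i, (skel^[n] f s).isSome = (skel^[n] f' s).isSome) (n : ℕ) :
    (rowState (skel^[n] f) i).card = (rowState (skel^[n] f') i).card := by
  induction i with
  | zero => rfl
  | succ i ih =>
    have ih := ih fun n s hs => h n s (by omega)
    have e1 := card_rowStep (X := rowState (skel^[n] f) i) (x := skel^[n] f (i + 1))
      fun z hz => (isInsertion_skel hf i).notMem hz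
    have e2 := card_rowStep (X := rowState (skel^[n] f') i) (x := skel^[n] f' (i + 1))
      fun z hz => (isInsertion_skel hf' i).notMem hz
    have b1 : bump (rowState (skel^[n] f) i) (skel^[n] f (i + 1)) = skel^[n + 1] f (i + 1) :=
      (isInsertion_skel hf i).bump_eq n
    have b2 : bump (rowState (skel^[n] f') i) (skel^[n] f' (i + 1)) = skel^[n + 1] f' (i + 1) :=
      (isInsertion_skel hf' i).bump_eq n
    rw [b1, h _ _ le_rfl, h _ _ le_rfl] at e1
    rw [b2] at e2
    show (rowStep _ _).card = (rowStep _ _).card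
    omega

theorem IsSmallestOccurrence.unique {F P : Finset Square} (hP : IsRookPlacement F P) {k : ℕ}
    {S T : Fin k → Square} (hS : IsSmallestOccurrence F P S) (hT : IsSmallestOccurrence F P T) :
    S = T := by
  have h : (fun t => (S t).2) = fun t => (T t).2 :=
    toLex.injective (le_antisymm (hS.2 T hT.1) (hT.2 S hS.1))
  funext t
  exact hP.2.2 _ (hS.1.1 t) _ (hT.1.1 t) (congrFun h t)

/-- The smallest occurrence is unique, so the choice made in `phi` is immaterial. -/
theorem phi_eq {F P : Finset Square} (hP : IsRookPlacement F P) {k : ℕ}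
    {S : Fin k → Square} (hS : IsSmallestOccurrence F P S) : phi k F P = cycleRows P S := by
  have h : ∃ S : Fin k → Square, IsSmallestOccurrence F P S := ⟨S, hS⟩
  rw [phi, dif_pos h, h.choose_spec.unique hP hS]

/-- The consequences for growth diagrams and tableaux of a shift of words. -/
theorem IsMinimalDescent.tableaux_eq {f f' : ℕ → Option ℕ} {k : ℕ} {c r : ℕ → ℕ} (hk : 1 ≤ k)
    (h : IsMinimalDescent f k c r) (hf' : IsShift f f' k c r) (hinj : WordInj f')
    (hpos : ∀ s v, f' s = some v → 1 ≤ s ∧ 1 ≤ v ∧ v < r 1) :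
    (∀ j < r 1, rowCount (fun n => rowState (skel^[n] f) (c k)) j =
      rowCount (fun n => rowState (skel^[n] f') (c k)) j) ∧
    (∀ i < c k, rowCount (fun n => rowState (skel^[n] f) i) (r 1) =
      rowCount (fun n => rowState (skel^[n] f') i) (r 1)) ∧
    (rsRun (cut (r 1 - 1) f) (c k)).1 = (rsRun f' (c k)).1 ∧
    (rsRun f (c k - 1)).2 = (rsRun f' (c k - 1)).2 := by
  have key := fun n => h.iterate_skel hk hf' n
  have hfilter : ∀ n, ∀ j < r 1, (rowState (skel^[n] f) (c k)).filter (· ≤ j) =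
      (rowState (skel^[n] f') (c k)).filter (· ≤ j) := by
    intro n j hj
    have herase : ∀ X : Finset ℕ, X.filter (· ≤ j) = (X.erase (r 1)).filter (· ≤ j) := by
      intro X
      ext e
      simp only [Finset.mem_filter, Finset.mem_erase]
      constructor
      · rintro ⟨h1, h2⟩; exact ⟨⟨by omega, h1⟩, h2⟩
      · rintro ⟨⟨-, h1⟩, h2⟩; exact ⟨h1, h2⟩
    rw [herase, (key n).1, ← herase]
  have hk1 := h.col_lt_col (s := 0) (t := k) (by omega) le_rfl
  have hr1 := h.row_lt 1 (by omega)
  have hcutinj : WordInj (cut (r 1 - 1) f) := by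
    intro s s' v h1 h2
    exact h.inj s s' v (Option.filter_eq_some_iff.1 h1).1 (Option.filter_eq_some_iff.1 h2).1
  -- The second word has no letter `r 1`, so both insertion tableaux arise from words cut at `r 1 -
  -- 1`.
  have hcut' : cut (r 1 - 1) f' = f' := by
    funext s
    cases hs : f' s with
    | none => simp [cut, hs]
    | some v =>
      have := hpos s v hs
      rw [cut, hs, Option.filter_some, if_pos (by simp; omega)]
  refine ⟨fun j hj => ?_, fun i hi => ?_, ?_, ?_⟩
  · funext n
    unfold rowCount
    rw [hfilter n j hj]
  · funext n
    -- No letter exceeds `r 1`, so on the top edge the counts are the full row lengths.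
    have hall : ∀ {g : ℕ → Option ℕ}, (∀ s v, g s = some v → v ≤ r 1) →
        (rowState (skel^[n] g) i).filter (· ≤ r 1) = rowState (skel^[n] g) i := by
      intro g hg
      refine Finset.filter_true_of_mem fun e he => ?_
      obtain ⟨s, -, h2, h3⟩ := exists_of_mem_rowState he
      obtain ⟨s', h4, h5⟩ :=
        exists_of_iterate_skel (n := 0) (m := n) (by rw [Nat.zero_add]; exact h3)
      exact hg _ _ h5
    unfold rowCount
    rw [hall fun s v hv => (h.pos s v hv).2.2, hall fun s v hv => (hpos s v hv).2.2.le]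
    exact card_rowState_congr h.inj hinj (fun n s hs => (key n).2 s (by omega)) n
  · refine rsRun_fst_congr hcutinj hinj fun n => ?_
    rw [← hcut', iterate_skel_cut, iterate_skel_cut, rowState_cut, rowState_cut]
    exact hfilter n _ (by omega)
  · exact rsRun_snd_congr h.inj hinj fun n s hs => (key n).2 s (by omega)

theorem mem_cycleRows {P : Finset Square} {K : ℕ} {S : Fin (K + 1) → Square} {c r : ℕ → ℕ}
    (hS : ∀ i : Fin (K + 1), S i = (c (i + 1), r (i + 1))) {x : Square} :
    x ∈ cycleRows P S ↔ (x ∈ P ∧ ∀ t, 1 ≤ t → t ≤ K + 1 → x ≠ (c t, r t)) ∨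
      (∃ t, 1 ≤ t ∧ t ≤ K ∧ x = (c t, r (t + 1))) ∨ x = (c (K + 1), r 1) := by
  simp only [cycleRows, Finset.mem_union, Finset.mem_sdiff, Finset.mem_image, Finset.mem_univ,
    true_and, not_exists]
  refine or_congr (and_congr_right fun _ => ?_) ?_
  · constructor
    · rintro h t h1 h2 rfl
      refine h ⟨t - 1, by omega⟩ ?_
      rw [hS]
      simp only [show t - 1 + 1 = t by omega]
    · intro h i hi
      rw [hS] at hi
      exact h (i + 1) (by omega) (by omega) hi.symm
  · constructor
    · rintro ⟨⟨i, hi⟩, rfl⟩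
      rcases Nat.lt_or_ge i K with h | h
      · left
        refine ⟨i + 1, by omega, by omega, ?_⟩
        rw [finRotate_of_lt h, hS, hS]
      · obtain rfl : i = K := by omega
        right
        have : finRotate (i + 1) ⟨i, hi⟩ = 0 := finRotate_last
        rw [this, hS, hS]
        rfl
    · rintro (⟨t, h1, h2, rfl⟩ | rfl)
      · refine ⟨⟨t - 1, by omega⟩, ?_⟩
        rw [finRotate_of_lt (by omega), hS, hS]
        simp only [show t - 1 + 1 = t by omega]
      · refine ⟨Fin.last K, ?_⟩
        rw [finRotate_last, hS, hS]
        rfl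

/-- The comparison of a placement and its image under `φ` in the rectangle spanned by the smallest
occurrence of `(K + 1) ⋯ 1`. -/
theorem isLeast_rect_and_phi_agreement (K : ℕ) (F P : Finset Square)
    (hF : IsFerrersBoard F) (hP : IsRookPlacement F P)
    (S : Fin (K + 1) → Square) (hS : IsSmallestOccurrence F P S)
    (a b : ℕ) (ha : a = (S (Fin.last K)).1) (hb : b = (S 0).2) :
    IsLeast {R : Finset Square |
      (∃ i j, R = rect i j) ∧ R ⊆ F ∧ ∀ t, S t ∈ R} (rect a b) ∧
    (∀ i j, ((i < a ∧ j = b) ∨ (i = a ∧ j < b)) →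
      growth (P ∩ rect a b) i j = growth (phi (K + 1) F P ∩ rect a b) i j) ∧
    ins (P ∩ rect a (b - 1)) = ins (phi (K + 1) F P ∩ rect a (b - 1)) ∧
    recT (P ∩ rect (a - 1) b) = recT (phi (K + 1) F P ∩ rect (a - 1) b) := by
  rw [phi_eq hP hS]
  obtain ⟨⟨hSP, hScol, hSrow, p, q, hpqF, hSpq⟩, hSmin⟩ := hS
  have hSF : ∀ t, S t ∈ F := fun t => hP.1 (hSP t)
  have hSa : ∀ t, (S t).1 ≤ a := fun t => by rw [ha]; exact hScol.monotone (Fin.le_last t)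
  have hSb : ∀ t, (S t).2 ≤ b := fun t => by rw [hb]; exact hSrow.antitone (Fin.zero_le t)
  have hSR : ∀ t, S t ∈ rect a b := by
    intro t
    have := hF _ (hSF t)
    exact mem_rect.2 ⟨⟨this.1, hSa t⟩, this.2.1, hSb t⟩
  have hb1 : 1 ≤ b := by rw [hb]; exact (hF _ (hSF 0)).2.1
  have ha1 : 1 ≤ a := by rw [ha]; exact (hF _ (hSF (Fin.last K))).1
  have hRF : rect a b ⊆ F := by
    -- The upper right corner `q` of a rectangle containing the occurrence lies weakly above and to
    -- the right of `(a, b)`.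
    have hq : q ∈ F := by
      have := Finset.mem_Icc.1 (hSpq 0)
      exact hpqF (Finset.mem_Icc.2 ⟨this.1.trans this.2, le_rfl⟩)
    have h1 := (Finset.mem_Icc.1 (hSpq 0)).2.2
    have h2 := (Finset.mem_Icc.1 (hSpq (Fin.last K))).2.1
    rw [← hb] at h1
    rw [← ha] at h2
    intro x hx
    refine (hF q hq).2.2 (mem_rect.2 ?_)
    have := mem_rect.1 hx
    exact ⟨⟨this.1.1, this.1.2.trans h2⟩, this.2.1, this.2.2.trans h1⟩
  refine ⟨⟨⟨⟨a, b, rfl⟩, hRF, hSR⟩, ?_⟩, ?_⟩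
  · rintro R ⟨⟨i, j, rfl⟩, -, hSi⟩ x hx
    have h1 := (mem_rect.1 (hSi (Fin.last K))).1.2
    have h2 := (mem_rect.1 (hSi 0)).2.2
    have := mem_rect.1 hx
    exact mem_rect.2 ⟨⟨this.1.1, by omega⟩, this.2.1, by omega⟩
  -- the distinguished squares, numbered from `1`
  obtain ⟨c, hc⟩ : ∃ c : ℕ → ℕ, ∀ t, c t =
      if h : 1 ≤ t ∧ t ≤ K + 1 then (S ⟨t - 1, by omega⟩).1 else 0 := ⟨_, fun _ => rfl⟩
  -- The sentinels `r 0 = b + 1` and `r (K + 2) = 0`, with `c 0 = 0`, lie just outside the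
  -- rectangle, so the end segments need no separate treatment.
  obtain ⟨r, hr⟩ : ∃ r : ℕ → ℕ, ∀ t, r t =
      if h : 1 ≤ t ∧ t ≤ K + 1 then (S ⟨t - 1, by omega⟩).2 else if t = 0 then b + 1 else 0 :=
    ⟨_, fun _ => rfl⟩
  have hScr : ∀ i : Fin (K + 1), S i = (c (i + 1), r (i + 1)) := by
    intro i
    have : 1 ≤ (i : ℕ) + 1 ∧ (i : ℕ) + 1 ≤ K + 1 := by omega
    rw [hc, hr, dif_pos this, dif_pos this]
    rfl
  have hcrS : ∀ t, 1 ≤ t → t ≤ K + 1 → ∃ i, (c t, r t) = S i := by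
    intro t h1 h2
    refine ⟨⟨t - 1, by omega⟩, ?_⟩
    rw [hScr]
    simp only [show t - 1 + 1 = t by omega]
  have hr1 : r 1 = b := by rw [hb, hScr 0]; rfl
  have hca : c (K + 1) = a := by rw [ha, hScr (Fin.last K)]; rfl
  have hlt : ∀ t, 1 ≤ t → t ≤ K → c t < c (t + 1) ∧ r (t + 1) < r t := by
    intro t h1 h2
    have hi : (⟨t - 1, by omega⟩ : Fin (K + 1)) < ⟨t, by omega⟩ := by
      rw [Fin.mk_lt_mk]; omega
    have g1 := hScol hi
    have g2 := hSrow hi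
    simp only [hScr, show t - 1 + 1 = t by omega] at g1 g2
    exact ⟨g1, g2⟩
  have hPR1 : ∀ x ∈ P ∩ rect a b, ∀ y ∈ P ∩ rect a b, x.1 = y.1 → x = y := fun x hx y hy =>
    hP.2.1 x (Finset.mem_inter.1 hx).1 y (Finset.mem_inter.1 hy).1
  have hf : ∀ i j, word (P ∩ rect a b) i = some j ↔ (i, j) ∈ P ∩ rect a b :=
    fun i j => word_eq_some hPR1
  set f := word (P ∩ rect a b) with hfdef
  have hmd : IsMinimalDescent f (K + 1) c r := by
    refine isMinimalDescent_of_min ?_ ?_ ?_ ?_ ?_ hlt ?_ ?_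
    · intro s s' v h1 h2
      rw [hf, Finset.mem_inter] at h1 h2
      exact congrArg Prod.fst (hP.2.2 _ h1.1 _ h2.1 rfl)
    · intro s v h
      rw [hf, Finset.mem_inter, mem_rect] at h
      rw [hr1]
      exact ⟨h.2.1.1, h.2.2⟩
    · rw [hc, dif_neg (by omega)]
    · rw [hr1, hr, dif_neg (by omega), if_pos rfl]
    · rw [hr, dif_neg (by omega), if_neg (by omega)]
    · intro t h1 h2
      obtain ⟨i, hi⟩ := hcrS t h1 h2
      rw [hf, hi]
      exact Finset.mem_inter.2 ⟨hSP i, hSR i⟩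
    · intro T hT q hq hTq hlt
      have hTm : ∀ t : Fin (K + 1), T t ∈ P ∩ rect a b := by
        intro t
        have := hT.1 t (by omega)
        rw [hf] at this
        exact this
      have hocc : IsOccurrence F P (fun t : Fin (K + 1) => T t) := by
        refine ⟨fun t => (Finset.mem_inter.1 (hTm t)).1, fun i j hij => ?_, fun i j hij => ?_,
          (1, 1), (a, b), fun x hx => hRF ?_, fun t => ?_⟩
        · exact (hT.lt (i := i) (j := j) hij (by omega)).1
        · exact (hT.lt (i := i) (j := j) hij (by omega)).2
        · obtain ⟨⟨h1, h2⟩, h3, h4⟩ := Finset.mem_Icc.1 hx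
          exact mem_rect.2 ⟨⟨h1, h3⟩, h2, h4⟩
        · obtain ⟨⟨h1, h2⟩, h3, h4⟩ := mem_rect.1 (Finset.mem_inter.1 (hTm t)).2
          exact Finset.mem_Icc.2 ⟨⟨h1, h3⟩, h2, h4⟩
      refine absurd (hSmin _ hocc) (not_le.2 ?_)
      -- Strict lexicographic inequality is given by the first index of difference, here `q`.
      refine ⟨⟨q, by omega⟩, fun j hj => ?_, ?_⟩
      · show (T j).2 = (S j).2
        rw [hScr]
        exact hTq j hj
      · show (T q).2 < (S ⟨q, _⟩).2
        rw [hScr]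
        exact hlt
  -- the placement `φ(P)` below the top row of the rectangle
  have hQ : ∀ x : Square, x ∈ cycleRows P S ∩ rect a (b - 1) ↔
      (x ∈ P ∩ rect a b ∧ ∀ t, 1 ≤ t → t ≤ K + 1 → x ≠ (c t, r t)) ∨
        ∃ t, 1 ≤ t ∧ t ≤ K ∧ x = (c t, r (t + 1)) := by
    intro x
    rw [Finset.mem_inter, mem_cycleRows hScr, Finset.mem_inter, mem_rect, mem_rect, hr1]
    constructor
    · rintro ⟨⟨h1, h2⟩ | h | rfl, h3⟩
      · exact Or.inl ⟨⟨h1, h3.1, h3.2.1, by omega⟩, h2⟩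
      · exact Or.inr h
      · simp at h3; omega
    · rintro (⟨⟨h1, h2⟩, h3⟩ | ⟨t, h1, h2, rfl⟩)
      · refine ⟨Or.inl ⟨h1, h3⟩, h2.1, h2.2.1, ?_⟩
        have : x.2 ≠ b := by
          intro hxb
          refine h3 1 le_rfl (by omega) ?_
          obtain ⟨i, hi⟩ := hcrS 1 le_rfl (by omega)
          rw [hi]
          refine hP.2.2 _ h1 _ (hSP i) ?_
          rw [← hi, hr1, hxb]
        omega
      · refine ⟨Or.inr (Or.inl ⟨t, h1, h2, rfl⟩), ?_⟩
        obtain ⟨i, hi⟩ := hcrS t h1 (by omega)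
        obtain ⟨i', hi'⟩ := hcrS (t + 1) (by omega) (by omega)
        have g1 := mem_rect.1 (hSR i)
        have g2 := mem_rect.1 (hSR i')
        rw [← hi] at g1
        rw [← hi'] at g2
        have g3 : r (t + 1) < r 1 := by
          have := (hlt t h1 h2).2
          obtain ⟨g4, -⟩ := g1.2
          have := g1.2.2
          simp only at this
          omega
        exact ⟨g1.1, g2.2.1, by simp only; omega⟩
  have hcne : ∀ t t', 1 ≤ t → t ≤ K + 1 → 1 ≤ t' → t' ≤ K + 1 → c t = c t' → t = t' := by
    intro t t' h1 h2 h3 h4 h5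
    rcases Nat.lt_trichotomy t t' with h | h | h
    · have := hmd.col_lt_col h h4; omega
    · exact h
    · have := hmd.col_lt_col h h2; omega
  have hmemS : ∀ t, 1 ≤ t → t ≤ K + 1 → (c t, r t) ∈ P := by
    intro t h1 h2
    obtain ⟨i, hi⟩ := hcrS t h1 h2
    rw [hi]; exact hSP i
  have hQ1 : ∀ x ∈ cycleRows P S ∩ rect a (b - 1), ∀ y ∈ cycleRows P S ∩ rect a (b - 1),
      x.1 = y.1 → x = y := by
    intro x hx y hy hxy
    rw [hQ] at hx hy
    rcases hx with ⟨h1, h2⟩ | ⟨t, h1, h2, rfl⟩ <;> rcases hy with ⟨h3, h4⟩ | ⟨t', h3, h4, rfl⟩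
    · exact hPR1 x h1 y h3 hxy
    · exact absurd (hP.2.1 _ (Finset.mem_inter.1 h1).1 _ (hmemS t' h3 (by omega)) hxy)
        (h2 t' h3 (by omega))
    · exact absurd (hP.2.1 _ (Finset.mem_inter.1 h3).1 _ (hmemS t h1 (by omega)) hxy.symm)
        (h4 t h1 (by omega))
    · rw [hcne t t' h1 (by omega) h3 (by omega) hxy]
  have hf' : ∀ i j, word (cycleRows P S ∩ rect a (b - 1)) i = some j ↔
      (i, j) ∈ cycleRows P S ∩ rect a (b - 1) := fun i j => word_eq_some hQ1
  set f' := word (cycleRows P S ∩ rect a (b - 1)) with hfdef'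
  have hinj' : WordInj f' := by
    intro s s' v hs hs'
    rw [hf', hQ] at hs hs'
    rcases hs with ⟨h1, h2⟩ | ⟨t, h1, h2, h5⟩ <;> rcases hs' with ⟨h3, h4⟩ | ⟨t', h3, h4, h6⟩
    · exact congrArg Prod.fst
        (hP.2.2 _ (Finset.mem_inter.1 h1).1 _ (Finset.mem_inter.1 h3).1 rfl)
    · exact absurd (hP.2.2 _ (Finset.mem_inter.1 h1).1 _ (hmemS (t' + 1) (by omega) (by omega))
        (Prod.ext_iff.1 h6).2) (h2 (t' + 1) (by omega) (by omega))
    · exact absurd (hP.2.2 _ (Finset.mem_inter.1 h3).1 _ (hmemS (t + 1) (by omega) (by omega))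
        (Prod.ext_iff.1 h5).2) (h4 (t + 1) (by omega) (by omega))
    · have g1 : r (t + 1) = r (t' + 1) := (Prod.ext_iff.1 h5).2.symm.trans (Prod.ext_iff.1 h6).2
      have g2 := hP.2.2 _ (hmemS (t + 1) (by omega) (by omega)) _
        (hmemS (t' + 1) (by omega) (by omega)) g1
      have g3 := hcne _ _ (by omega) (by omega) (by omega) (by omega) (Prod.ext_iff.1 g2).1
      obtain rfl : t = t' := by omega
      exact (Prod.ext_iff.1 h5).1.trans (Prod.ext_iff.1 h6).1.symm
  have hpos' : ∀ s v, f' s = some v → 1 ≤ s ∧ 1 ≤ v ∧ v < r 1 := by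
    intro s v h
    rw [hf', Finset.mem_inter, mem_rect] at h
    simp only at h
    omega
  have hsh : IsShift f f' (K + 1) c r := by
    constructor
    · intro t h1 h2
      rw [hf', hQ]
      exact Or.inr ⟨t, h1, by omega, rfl⟩
    · rw [Option.eq_none_iff_forall_ne_some]
      intro v hv
      rw [hf', hQ] at hv
      rcases hv with ⟨h1, h2⟩ | ⟨t, h1, h2, h5⟩
      · exact h2 (K + 1) (by omega) le_rfl (hP.2.1 _ (Finset.mem_inter.1 h1).1 _
          (hmemS (K + 1) (by omega) le_rfl) rfl)
      · have := hcne _ _ (by omega) le_rfl h1 (by omega) (Prod.ext_iff.1 h5).1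
        omega
    · intro s hs hne
      ext v
      show f' s = some v ↔ f s = some v
      rw [hf', hQ, hf]
      constructor
      · rintro (⟨h1, -⟩ | ⟨t, h1, h2, h5⟩)
        · exact h1
        · exact absurd (Prod.ext_iff.1 h5).1 (hne t h1 (by omega))
      · intro h
        exact Or.inl ⟨h, fun t h1 h2 h3 => hne t h1 h2 (Prod.ext_iff.1 h3).1⟩
  obtain ⟨t1, t2, t3, t4⟩ := hmd.tableaux_eq (by omega) hsh hinj' hpos'
  rw [hca, hr1] at t1 t2 t3
  rw [hca] at t4
  have hgP : ∀ i j, growth (P ∩ rect a b) i j = rowCount (fun n => rowState (skel^[n] f) i) j :=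
    growth_eq_rowCount hmd.inj (fun s v h => (hmd.pos s v h).2.1) fun i j => (hf _ _).symm
  have hgQ : ∀ i j, growth (cycleRows P S ∩ rect a (b - 1)) i j =
      rowCount (fun n => rowState (skel^[n] f') i) j :=
    growth_eq_rowCount hinj' (fun s v h => (hpos' s v h).2.1) fun i j => (hf' _ _).symm
  -- the only marker of `φ(P)` in the top row of the rectangle is the corner
  have htop : ∀ x : Square, x.1 < a → (x ∈ cycleRows P S ∩ rect a b ↔
      x ∈ cycleRows P S ∩ rect a (b - 1)) := by
    intro x hxa
    rw [hQ, Finset.mem_inter, mem_cycleRows hScr, hca]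
    constructor
    · rintro ⟨⟨h1, h2⟩ | h | rfl, h3⟩
      · exact Or.inl ⟨Finset.mem_inter.2 ⟨h1, h3⟩, h2⟩
      · exact Or.inr h
      · simp at hxa
    · rintro (⟨h1, h2⟩ | ⟨t, h1, h2, rfl⟩)
      · exact ⟨Or.inl ⟨(Finset.mem_inter.1 h1).1, h2⟩, (Finset.mem_inter.1 h1).2⟩
      · have := (hQ (c t, r (t + 1))).2 (Or.inr ⟨t, h1, h2, rfl⟩)
        rw [Finset.mem_inter, mem_rect] at this
        exact ⟨Or.inr (Or.inl ⟨t, h1, h2, rfl⟩),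
          mem_rect.2 ⟨this.2.1, this.2.2.1, by omega⟩⟩
  refine ⟨?_, ?_, ?_⟩
  · rintro i j (⟨hi, rfl⟩ | ⟨rfl, hj⟩)
    -- A point of the top edge before the corner sees only columns left of `a`, and one of the right
    -- edge only rows below `b`; the marker at `(a, b)` can be dropped in both cases.
    · rw [growth_congr (Q := cycleRows P S ∩ rect a (j - 1)) (a := i) (b := j)
        (fun x h1 _ => htop x (by omega)) i le_rfl j le_rfl, hgP, hgQ]
      exact t2 i hi
    · rw [growth_congr (P := cycleRows P S ∩ rect i b) (Q := cycleRows P S ∩ rect i (b - 1))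
        (a := i) (b := j) ?_ i le_rfl j le_rfl, hgP, hgQ]
      · exact t1 j hj
      · intro x _ hx
        rw [Finset.mem_inter, Finset.mem_inter, mem_rect, mem_rect]
        refine and_congr_right fun _ => and_congr_right fun _ => and_congr_right fun _ => ?_
        omega
  · rw [ins_eq (f := cut (b - 1) f) (N := a), ins_eq (f := f') (N := a)]
    · exact t3
    · intro i j
      rw [hf', Finset.mem_inter, mem_rect]
      tauto
    · intro i j
      rw [cut, Option.filter_eq_some_iff, hf, Finset.mem_inter, Finset.mem_inter, mem_rect,
        mem_rect, decide_eq_true_eq]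
      simp only
      constructor
      · rintro ⟨h1, ⟨h2, h3⟩, h4, h5⟩
        exact ⟨h2, h3, ⟨h1, ⟨h2, h3⟩, h4, by omega⟩, h5⟩
      · rintro ⟨h2, h3, ⟨h1, -, h4, -⟩, h5⟩
        exact ⟨h1, ⟨h2, h3⟩, h4, h5⟩
  · rw [recT_eq (f := f) (N := a - 1), recT_eq (f := f') (N := a - 1)]
    · exact t4
    · intro i j
      have := htop (i, j)
      rw [hf', Finset.mem_inter, mem_rect]
      rw [Finset.mem_inter, mem_rect] at this
      simp only at this ⊢
      constructor
      · rintro ⟨h1, ⟨h2, h3⟩, h4, h5⟩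
        exact ⟨h2, h3, (this (by omega)).1 ⟨h1, ⟨h2, by omega⟩, h4, h5⟩⟩
      · rintro ⟨h2, h3, h1⟩
        have := (this (by omega)).2 h1
        exact ⟨this.1, ⟨h2, h3⟩, this.2.2⟩
    · intro i j
      rw [hf, Finset.mem_inter, Finset.mem_inter, mem_rect, mem_rect]
      simp only
      constructor
      · rintro ⟨h1, ⟨h2, h3⟩, h4, h5⟩
        exact ⟨h2, h3, h1, ⟨h2, by omega⟩, h4, h5⟩
      · rintro ⟨h2, h3, h1, -, h4, h5⟩
        exact ⟨h1, ⟨h2, h3⟩, h4, h5⟩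

end RookGrowth

theorem mainTheorem3 (k : ℕ) (hk : 2 ≤ k) (F P : Finset RookGrowth.Square)
    (hF : RookGrowth.IsFerrersBoard F) (hP : RookGrowth.IsRookPlacement F P)
    (S : Fin k → RookGrowth.Square) (hS : RookGrowth.IsSmallestOccurrence F P S)
    (a b : ℕ) (ha : a = (S ⟨k - 1, by omega⟩).1) (hb : b = (S ⟨0, by omega⟩).2) :
    -- `R(a, b)` is the smallest rectangular subboard containing `S` and extending to the
    -- left and bottom edges
    IsLeast {R : Finset RookGrowth.Square |
      (∃ i j, R = RookGrowth.rect i j) ∧ R ⊆ F ∧ ∀ t, S t ∈ R} (RookGrowth.rect a b) ∧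
    (∀ c : RookGrowth.border (RookGrowth.rect a b), c.1 ≠ (a, b) →
      RookGrowth.borderSeq (P ∩ RookGrowth.rect a b) (RookGrowth.rect a b) c =
        RookGrowth.borderSeq (RookGrowth.phi k F P ∩ RookGrowth.rect a b)
          (RookGrowth.rect a b) c) ∧
    RookGrowth.ins (P ∩ RookGrowth.rect a (b - 1)) =
      RookGrowth.ins (RookGrowth.phi k F P ∩ RookGrowth.rect a (b - 1)) ∧
    RookGrowth.recT (P ∩ RookGrowth.rect (a - 1) b) =
      RookGrowth.recT (RookGrowth.phi k F P ∩ RookGrowth.rect (a - 1) b) := by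
  obtain ⟨K, rfl⟩ : ∃ K, k = K + 1 := ⟨k - 1, by omega⟩
  obtain ⟨h1, h2, h3⟩ :=
    RookGrowth.isLeast_rect_and_phi_agreement K F P hF hP S hS a b ha hb
  refine ⟨h1, ?_, h3⟩
  -- A border point of the rectangle other than its corner has `j = b` and `i < a`, or `i = a` and
  -- `j < b`.
  rintro ⟨⟨i, j⟩, ⟨x, hx, hxi, hxj⟩, hc⟩ hne
  refine h2 i j ?_
  have hx := RookGrowth.mem_rect.1 hx
  rw [RookGrowth.mem_rect] at hc
  simp only [ne_eq, Prod.mk.injEq] at hxi hxj hc hne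
  omega
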